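/- Let $n\ge 2$, let $(M,g)$ be a smooth $(n+1)$-dimensional pseudo-Riemannian manifold (of any signature) of constant curvature, with Levi-Civita connection $\hat\nabla$ and volume form $\mathrm{vol}_g$, and let $\Sigma$ be a connected co-oriented smooth immersed hypersurface in $M$. A vector field $N$ along $\Sigma$ transverse to $\Sigma$ determines on $\Sigma$ a connection $\nabla$, a symmetric tensor $h$, an endomorphism $S$ (the shape operator) and a one-form $\tau$ by $$\hat\nabla_XY=\nabla_XY+h(X,Y)N,\qquad \hat\nabla_XN=-S(X)+\tau(X)N$$ for $X,Y$ tangent to $\Sigma$; the mean curvature with respect to $N$ is $\tfrac1n\operatorname{tr}S$. Suppose that $\Sigma$ is nondegenerate with respect to $\hat\nabla$, that is, its second fundamental form (equivalently $h$, for one and hence every $N$) is nondegenerate at every point, and that the restriction of $g$ to $\Sigma$ is nondegenerate. Let $E$ be the co-oriented vector field along $\Sigma$ that is $g$-orthogonal to $\Sigma$ and satisfies $|g(E,E)|=1$. The pseudo-Riemannian mean curvature of $\Sigma$ is the mean curvature with respect to $E$, and its Gauss--Kronecker curvature is the determinant of the shape operator with respect to $E$. Let $\mathsf{N}$ be the co-oriented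 equiaffine normal of $\Sigma$ determined by $\hat\nabla$ and $\mathrm{vol}_g$, that is, the co-oriented transverse vector field such that its induced $\nabla$ and $h$ satisfy $n\,h^{PQ}\nabla_Ph_{QI}=h^{PQ}\nabla_Ih_{PQ}$ and such that $|\iota(\mathsf N)\mathrm{vol}_g|=|\mathrm{vol}_h|$ as densities on $\Sigma$. The equiaffine mean curvature is the mean curvature with respect to $\mathsf N$. Then $\mathsf N$ and $E$ are proportional at every point of $\Sigma$ if and only if the Gauss--Kronecker curvature of $\Sigma$ is constant. In that case there is a constant $a>0$ such that $\mathsf N=aE$ along $\Sigma$ and the equiaffine mean curvature of $\Sigma$ equals $a$ times its pseudo-Riemannian mean curvature. -/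

import Mathlib

open scoped Manifold ContDiff

set_option maxSynthPendingDepth 3

noncomputable section

/-! Formulas of pseudo-Riemannian geometry in coordinates, for a metric `G` on a finite-dimensional
vector space `V` (or on an open subset of it). -/

namespace LocalMetric

variable {V : Type*} [NormedAddCommGroup V] [NormedSpace ℝ V]

/-- The Christoffel symbols of the first kind:
`(u, v, w) ↦ (∂_u G(v, w) + ∂_v G(u, w) - ∂_w G(u, v)) / 2`. -/
def christoffelFirst (G : V → V →L[ℝ] V →L[ℝ] ℝ) (y : V) : V →L[ℝ] V →L[ℝ] V →L[ℝ] ℝ :=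
  let dG : V →L[ℝ] V →L[ℝ] V →L[ℝ] ℝ := fderiv ℝ G y
  let dG₂ : V →L[ℝ] V →L[ℝ] V →L[ℝ] ℝ := dG.flip
  let dG₃ : V →L[ℝ] V →L[ℝ] V →L[ℝ] ℝ :=
    (ContinuousLinearMap.flipₗᵢ ℝ V V ℝ).toContinuousLinearEquiv.toContinuousLinearMap ∘L dG₂
  (1 / 2 : ℝ) • (dG + dG₂ - dG₃)

theorem christoffelFirst_apply (G : V → V →L[ℝ] V →L[ℝ] ℝ) (y u v w : V) :
    christoffelFirst G y u v w =
      (1 / 2) * (fderiv ℝ G y u v w + fderiv ℝ G y v u w - fderiv ℝ G y w u v) := by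
  simp [christoffelFirst]

/-- The Christoffel symbols (of the second kind) of the Levi-Civita connection: the vector
`Γ_y(u, v)` is characterized by `G_y(Γ_y(u, v), w) = christoffelFirst G y u v w`. -/
def christoffel (G : V → V →L[ℝ] V →L[ℝ] ℝ) (y : V) : V →L[ℝ] V →L[ℝ] V :=
  (ContinuousLinearMap.compL ℝ V (V →L[ℝ] ℝ) V (G y).inverse) ∘L christoffelFirst G y

theorem apply_christoffel (G : V → V →L[ℝ] V →L[ℝ] ℝ) (y : V) (hG : (G y).IsInvertible)
    (u v w : V) : G y (christoffel G y u v) w = christoffelFirst G y u v w := by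
  obtain ⟨e, he⟩ := hG
  simp [christoffel, ← he]

/-- The curvature `R(u, v)w = ∇_u ∇_v w - ∇_v ∇_u w - ∇_[u, v] w` of the Levi-Civita
connection. -/
def curvature (G : V → V →L[ℝ] V →L[ℝ] ℝ) (y u v w : V) : V :=
  fderiv ℝ (christoffel G) y u v w - fderiv ℝ (christoffel G) y v u w
    + christoffel G y u (christoffel G y v w) - christoffel G y v (christoffel G y u w)

end LocalMetric

/-- The model space `ℝᵐ`. -/
abbrev RSpace (m : ℕ) : Type := EuclideanSpace ℝ (Fin m)

/-- A (smooth) pseudo-Riemannian metric on an `m`-dimensional manifold: a smooth section of the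
bundle of bilinear forms on the tangent spaces, which is symmetric and nondegenerate at every
point. The signature is arbitrary. -/
structure PseudoRiemannianMetric (m : ℕ) (M : Type*) [TopologicalSpace M]
    [ChartedSpace (RSpace m) M] [IsManifold (𝓡 m) ∞ M] where
  /-- The scalar product on each tangent space. -/
  val (x : M) : TangentSpace (𝓡 m) x →L[ℝ] TangentSpace (𝓡 m) x →L[ℝ] ℝ
  symm (x : M) (v w : TangentSpace (𝓡 m) x) : val x v w = val x w v
  nondegenerate (x : M) (v : TangentSpace (𝓡 m) x) (hv : ∀ w, val x v w = 0) : v = 0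
  contMDiff : ContMDiff (𝓡 m) ((𝓡 m).prod 𝓘(ℝ, RSpace m →L[ℝ] RSpace m →L[ℝ] ℝ)) ∞
    (fun x ↦ Bundle.TotalSpace.mk' (RSpace m →L[ℝ] RSpace m →L[ℝ] ℝ) x (val x))

namespace PseudoRiemannianMetric

variable {m : ℕ} {M : Type*} [TopologicalSpace M] [ChartedSpace (RSpace m) M]
  [IsManifold (𝓡 m) ∞ M]

/-- The components of the metric in the preferred chart `φ` at `x₀`: the bilinear form
`G_y(u, v) = g(d(φ⁻¹)_y u, d(φ⁻¹)_y v)` on `ℝᵐ`, for `y` in the target of `φ`. -/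
def inChart (g : PseudoRiemannianMetric m M) (x₀ : M) (y : RSpace m) :
    RSpace m →L[ℝ] RSpace m →L[ℝ] ℝ :=
  let dφsymm : RSpace m →L[ℝ] TangentSpace (𝓡 m) ((extChartAt (𝓡 m) x₀).symm y) :=
    mfderiv 𝓘(ℝ, RSpace m) (𝓡 m) (extChartAt (𝓡 m) x₀).symm y
  (ContinuousLinearMap.precomp ℝ dφsymm) ∘L (g.val ((extChartAt (𝓡 m) x₀).symm y) ∘L dφsymm)

/-- The Christoffel symbols of the Levi-Civita connection in the chart at `x₀`. -/
def christoffel (g : PseudoRiemannianMetric m M) (x₀ : M) (y : RSpace m) :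
    RSpace m →L[ℝ] RSpace m →L[ℝ] RSpace m :=
  LocalMetric.christoffel (g.inChart x₀) y

/-- The curvature of the Levi-Civita connection in the chart at `x₀`. -/
def curvature (g : PseudoRiemannianMetric m M) (x₀ : M) (y u v w : RSpace m) : RSpace m :=
  LocalMetric.curvature (g.inChart x₀) y u v w

/-- `g` has constant curvature `c`: `R(u, v)w = c (g(v, w) u - g(u, w) v)` at every point. -/
def HasConstantCurvature (g : PseudoRiemannianMetric m M) (c : ℝ) : Prop :=
  ∀ (x : M) (u v w : RSpace m),
    let y := extChartAt (𝓡 m) x x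
    g.curvature x y u v w = c • (g.inChart x y v w • u - g.inChart x y u w • v)

end PseudoRiemannianMetric

namespace Hypersurface

variable {n : ℕ} {M : Type*} [TopologicalSpace M] [ChartedSpace (RSpace (n + 1)) M]
  [IsManifold (𝓡 (n + 1)) ∞ M]
  {S : Type*} [TopologicalSpace S] [ChartedSpace (RSpace n) S] [IsManifold (𝓡 n) ∞ S]

/-- A vector field along `f : S → M` (a section of `f^* TM`) is smooth. -/
def IsSmoothAlong (f : S → M) (W : (p : S) → TangentSpace (𝓡 (n + 1)) (f p)) : Prop :=
  ContMDiff (𝓡 n) (𝓡 (n + 1)).tangent ∞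
    (fun p ↦ (⟨f p, W p⟩ : TangentBundle (𝓡 (n + 1)) M))

variable (n) in
/-- `f : S → M` is a smooth immersion: it is smooth and its differential is injective at
every point. -/
def IsSmoothImmersion (f : S → M) : Prop :=
  ContMDiff (𝓡 n) (𝓡 (n + 1)) ∞ f ∧
    ∀ p, Function.Injective (mfderiv (𝓡 n) (𝓡 (n + 1)) f p)

/-- The vector field `f_* X` along `f` for a vector field `X` on `S`. -/
def pushforward (f : S → M) (X : (p : S) → TangentSpace (𝓡 n) p) (p : S) :
    TangentSpace (𝓡 (n + 1)) (f p) :=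
  mfderiv (𝓡 n) (𝓡 (n + 1)) f p (X p)

/-- The Levi-Civita covariant derivative `u ↦ ∇̂_u W` at `p` of a vector field `W` along `f`. In
the preferred chart `φ` of `M` at `f p`, with `Ŵ = dφ(W)`, it is `∂_u Ŵ + Γ(dφ(df(u)), Ŵ)`. -/
def covDerivAlong (g : PseudoRiemannianMetric (n + 1) M) (f : S → M)
    (W : (p : S) → TangentSpace (𝓡 (n + 1)) (f p)) (p : S) :
    TangentSpace (𝓡 n) p →L[ℝ] TangentSpace (𝓡 (n + 1)) (f p) :=
  let φ : M → RSpace (n + 1) := extChartAt (𝓡 (n + 1)) (f p)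
  let dφ (x : M) : TangentSpace (𝓡 (n + 1)) x →L[ℝ] RSpace (n + 1) := mvfderiv (𝓡 (n + 1)) φ x
  let W' : S → RSpace (n + 1) := fun q ↦ dφ (f q) (W q)
  (dφ (f p)).inverse ∘L
    (mvfderiv (𝓡 n) W' p +
      (g.christoffel (f p) (φ (f p))).flip (W' p) ∘L
        (dφ (f p) ∘L mfderiv (𝓡 n) (𝓡 (n + 1)) f p))

/-- An extension of a tangent vector of `S` at `p` to a vector field on `S`, smooth near `p`. -/
def extendVector {p : S} (v : TangentSpace (𝓡 n) p) : (q : S) → TangentSpace (𝓡 n) q :=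
  FiberBundle.extend (RSpace n) v

/-- The map `T_p S × ℝ → T_{f p} M`, `(v, c) ↦ df(v) + c N`. It is an isomorphism, the splitting
`f^* TM = TS ⊕ ⟨N⟩`, when `f` is an immersion and `N` is transverse to `f`. -/
def splitting (f : S → M) (N : (p : S) → TangentSpace (𝓡 (n + 1)) (f p)) (p : S) :
    (TangentSpace (𝓡 n) p × ℝ) →L[ℝ] TangentSpace (𝓡 (n + 1)) (f p) :=
  (mfderiv (𝓡 n) (𝓡 (n + 1)) f p).coprod (ContinuousLinearMap.toSpanSingleton ℝ (N p))

/-- The tangential component, in `T_p S`, of a vector of `T_{f p} M`, with respect to `N`. -/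
def tangentialPart (f : S → M) (N : (p : S) → TangentSpace (𝓡 (n + 1)) (f p)) (p : S) :
    TangentSpace (𝓡 (n + 1)) (f p) →L[ℝ] TangentSpace (𝓡 n) p :=
  ContinuousLinearMap.fst ℝ (TangentSpace (𝓡 n) p) ℝ ∘L (splitting f N p).inverse

/-- The coefficient of `N` in a vector of `T_{f p} M`. -/
def transversePart (f : S → M) (N : (p : S) → TangentSpace (𝓡 (n + 1)) (f p)) (p : S) :
    TangentSpace (𝓡 (n + 1)) (f p) →L[ℝ] ℝ :=
  ContinuousLinearMap.snd ℝ (TangentSpace (𝓡 n) p) ℝ ∘L (splitting f N p).inverse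

/-- The connection `∇` induced on `S` by `N`: the tangential part of `∇̂_u (f_* X)`. -/
def inducedConnection (g : PseudoRiemannianMetric (n + 1) M) (f : S → M)
    (N : (p : S) → TangentSpace (𝓡 (n + 1)) (f p))
    (X : (p : S) → TangentSpace (𝓡 n) p) (p : S) (u : TangentSpace (𝓡 n) p) :
    TangentSpace (𝓡 n) p :=
  tangentialPart f N p (covDerivAlong g f (pushforward f X) p u)

/-- The representative `h` of the second fundamental form with respect to `N`: `h(u, v)` is
the coefficient of `N` in `∇̂_u (f_* V)`, for any vector field `V` extending `v`. -/
def secondForm (g : PseudoRiemannianMetric (n + 1) M) (f : S → M)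
    (N : (p : S) → TangentSpace (𝓡 (n + 1)) (f p)) (p : S) (u v : TangentSpace (𝓡 n) p) : ℝ :=
  transversePart f N p (covDerivAlong g f (pushforward f (extendVector v)) p u)

/-- The shape operator of `N`: minus the tangential part of `∇̂_u N`. -/
def shapeOperator (g : PseudoRiemannianMetric (n + 1) M) (f : S → M)
    (N : (p : S) → TangentSpace (𝓡 (n + 1)) (f p)) (p : S) :
    TangentSpace (𝓡 n) p →L[ℝ] TangentSpace (𝓡 n) p :=
  -(tangentialPart f N p ∘L covDerivAlong g f N p)

/-- The mean curvature `n⁻¹ tr S` with respect to `N`, where `S` is the shape operator. -/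
def meanCurvature (g : PseudoRiemannianMetric (n + 1) M) (f : S → M)
    (N : (p : S) → TangentSpace (𝓡 (n + 1)) (f p)) (p : S) : ℝ :=
  (n : ℝ)⁻¹ * LinearMap.trace ℝ (TangentSpace (𝓡 n) p) (shapeOperator g f N p).toLinearMap

/-- The determinant of the shape operator of `E`; the Gauss-Kronecker curvature when `E` is the
unimodular orthogonal field. -/
def gaussKroneckerCurvature (g : PseudoRiemannianMetric (n + 1) M) (f : S → M)
    (E : (p : S) → TangentSpace (𝓡 (n + 1)) (f p)) (p : S) : ℝ :=
  LinearMap.det (shapeOperator g f E p).toLinearMap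

/-- The covariant derivative of `h` with respect to the induced connection:
`(∇_u h)(v, w) = u(h(V, W)) - h(∇_u V, w) - h(v, ∇_u W)`, for vector fields `V`, `W` extending
`v`, `w`. -/
def covDerivSecondForm (g : PseudoRiemannianMetric (n + 1) M) (f : S → M)
    (N : (p : S) → TangentSpace (𝓡 (n + 1)) (f p)) (p : S) (u v w : TangentSpace (𝓡 n) p) : ℝ :=
  mvfderiv (𝓡 n) (fun q ↦ secondForm g f N q (extendVector v q) (extendVector w q)) p u
    - secondForm g f N p (inducedConnection g f N (extendVector v) p u) w
    - secondForm g f N p v (inducedConnection g f N (extendVector w) p u)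

/-- The connection induced by `N` is aligned with respect to the second fundamental form:
`n h^{ab} ∇_a h_{bw} = h^{ab} ∇_w h_{ab}`, in terms of a basis of the tangent space. -/
def IsAligned (g : PseudoRiemannianMetric (n + 1) M) (f : S → M)
    (N : (p : S) → TangentSpace (𝓡 (n + 1)) (f p)) : Prop :=
  ∀ (p : S) (b : Module.Basis (Fin n) ℝ (TangentSpace (𝓡 n) p)) (w : TangentSpace (𝓡 n) p),
    let hInv : Matrix (Fin n) (Fin n) ℝ :=
      (Matrix.of fun i j ↦ secondForm g f N p (b i) (b j))⁻¹
    (n : ℝ) * ∑ i, ∑ j, hInv i j * covDerivSecondForm g f N p (b i) (b j) w =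
      ∑ i, ∑ j, hInv i j * covDerivSecondForm g f N p w (b i) (b j)

/-- The volume density of a bilinear form: `|vol_B|(v₁, …, v_k) = |det B(v_i, v_j)|^{1/2}`. -/
def volDensity {V : Type*} {k : ℕ} (B : V → V → ℝ) (v : Fin k → V) : ℝ :=
  Real.sqrt |(Matrix.of fun i j ↦ B (v i) (v j)).det|

/-- A co-orientation of the immersion `f`, represented by a smooth field `ν` along `f` which is
nowhere tangent to `f`. -/
def IsCoorientation (f : S → M) (ν : (p : S) → TangentSpace (𝓡 (n + 1)) (f p)) : Prop :=
  IsSmoothAlong f ν ∧ ∀ p, ν p ∉ Set.range (mfderiv (𝓡 n) (𝓡 (n + 1)) f p)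

/-- `N` is co-oriented, i.e. is transverse and lies on the same side as `ν`: modulo vectors tangent
to the hypersurface, it is a positive multiple of `ν`. -/
def IsCooriented (f : S → M) (ν N : (p : S) → TangentSpace (𝓡 (n + 1)) (f p)) : Prop :=
  ∀ p, ∃ a : ℝ, 0 < a ∧ N p - a • ν p ∈ Set.range (mfderiv (𝓡 n) (𝓡 (n + 1)) f p)

/-- Nondegeneracy with respect to the Levi-Civita connection: the second fundamental form, with
values in `T_{f p} M / T_p S`, given by the class of `∇̂_u (f_* V)`, is nondegenerate. -/
def IsAffinelyNondegenerate (g : PseudoRiemannianMetric (n + 1) M) (f : S → M) : Prop :=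
  ∀ (p : S) (u : TangentSpace (𝓡 n) p),
    (∀ v : TangentSpace (𝓡 n) p,
      covDerivAlong g f (pushforward f (extendVector v)) p u ∈
        Set.range (mfderiv (𝓡 n) (𝓡 (n + 1)) f p)) → u = 0

/-- Metric nondegeneracy: the restriction of `g` to the hypersurface is nondegenerate. -/
def IsMetricallyNondegenerate (g : PseudoRiemannianMetric (n + 1) M) (f : S → M) : Prop :=
  ∀ (p : S) (u : TangentSpace (𝓡 n) p),
    (∀ v : TangentSpace (𝓡 n) p,
      g.val (f p) (mfderiv (𝓡 n) (𝓡 (n + 1)) f p u) (mfderiv (𝓡 n) (𝓡 (n + 1)) f p v) = 0) →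
    u = 0

/-- `E` is the co-oriented unimodular orthogonal vector field: `E` is `g`-orthogonal to the
hypersurface, `|g(E, E)| = 1`, and `E` is co-oriented. -/
structure IsUnimodularNormal (g : PseudoRiemannianMetric (n + 1) M) (f : S → M)
    (ν E : (p : S) → TangentSpace (𝓡 (n + 1)) (f p)) : Prop where
  smooth : IsSmoothAlong f E
  cooriented : IsCooriented f ν E
  orthogonal (p : S) (v : TangentSpace (𝓡 n) p) :
    g.val (f p) (E p) (mfderiv (𝓡 n) (𝓡 (n + 1)) f p v) = 0
  unimodular (p : S) : |g.val (f p) (E p) (E p)| = 1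

/-- `N` is the co-oriented equiaffine normal determined by the Levi-Civita connection of `g` and
the volume form of `g`: the connection induced by `N` is aligned with respect to the second
fundamental form, `|ι(N) vol_g| = |vol_h|` for the representative `h` of the second fundamental
form determined by `N`, and `N` is co-oriented. -/
structure IsEquiaffineNormal (g : PseudoRiemannianMetric (n + 1) M) (f : S → M)
    (ν N : (p : S) → TangentSpace (𝓡 (n + 1)) (f p)) : Prop where
  smooth : IsSmoothAlong f N
  cooriented : IsCooriented f ν N
  aligned : IsAligned g f N
  volume (p : S) (v : Fin n → TangentSpace (𝓡 n) p) :
    volDensity (fun x y ↦ g.val (f p) x y)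
        (Matrix.vecCons (N p) fun i ↦ mfderiv (𝓡 n) (𝓡 (n + 1)) f p (v i)) =
      volDensity (secondForm g f N p) v

end Hypersurface

end

set_option linter.unusedSectionVars false

noncomputable section

namespace LocalMetric

open Filter Topology

/-! ### Product rules for bilinear expressions -/

section calculus

variable {X V W R : Type*} [NormedAddCommGroup X] [NormedSpace ℝ X]
  [NormedAddCommGroup V] [NormedSpace ℝ V] [NormedAddCommGroup W] [NormedSpace ℝ W]
  [NormedAddCommGroup R] [NormedSpace ℝ R]

/-! Write `N = a E + f_* z` with `a > 0`. The claim is that the tangential part `z` measures the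
logarithmic derivative of the Gauss-Kronecker curvature `K`. Let `h` and `∇` belong to `E`, let `I`
be the first fundamental form and `ε = g(E, E)`. All traces are taken with `h`.

Since `R(u, v)w` is a combination of `u` and `v` in constant curvature, it has no component along
`E`, so `∇h` is totally symmetric (Codazzi). Passing from `E` to `N` replaces `h` by `h / a` and
`∇_u v` by `∇_u v - a⁻¹ h(u, v) z`. Inserted in the alignment condition, these cancel the derivative
of `a` and leave `h^{ij} ∇_w h_{ij} = -((n + 2) / a) h(z, w)`; see `LinearMap.trace_eq_of_aligned`
and `trace_covDerivSecondForm`.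

On the other hand `det h = ε^n K det I`, and `∇I = 0`. Jacobi's formula therefore gives `dK(w) = K
h^{ij} ∇_w h_{ij}` (`hasFDerivAt_curvature`, `fderiv_gaussKroneckerCurvature`). Together, `dK = -((n
+ 2) K / a) h(z, ·)`. As `h` is nondegenerate, `K` vanishes nowhere, and so `dK = 0` exactly when `z
= 0`. Connectedness turns `dK = 0` into constancy of `K`.

When `z = 0`, comparing the two volume densities gives `a^(n + 2) = |K|`
(`pow_eq_abs_gaussKroneckerCurvature`). Constant `K` thus forces constant `a`, and then the shape
operators, hence the mean curvatures, differ by the factor `a`.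

The differential identities are proved for maps between vector spaces (`LocalMetric.IsNormalField`)
and carried to the manifold by `chartDeriv_covDerivAlong`, the invariance of the covariant
derivative under change of charts. Vectors are extended with constant components in the chart at the
base point, so that the intrinsic definitions become the coordinate ones there. -/

theorem fderiv_clm_apply₂ {c : X → V →L[ℝ] W →L[ℝ] R} {Y : X → V} {Z : X → W} {x : X}
    (hc : DifferentiableAt ℝ c x) (hY : DifferentiableAt ℝ Y x) (hZ : DifferentiableAt ℝ Z x)
    (u : X) :
    fderiv ℝ (fun x ↦ c x (Y x) (Z x)) x u =
      fderiv ℝ c x u (Y x) (Z x) + c x (fderiv ℝ Y x u) (Z x) + c x (Y x) (fderiv ℝ Z x u) := by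
  rw [fderiv_clm_apply (hc.clm_apply hY) hZ, fderiv_clm_apply hc hY]
  simp
  abel

theorem fderiv_comp_clm_apply₂ {G : R → V →L[ℝ] W →L[ℝ] ℝ} {F : X → R} {Y : X → V} {Z : X → W}
    {x : X} (hG : DifferentiableAt ℝ G (F x)) (hF : DifferentiableAt ℝ F x)
    (hY : DifferentiableAt ℝ Y x) (hZ : DifferentiableAt ℝ Z x) (u : X) :
    fderiv ℝ (fun x ↦ G (F x) (Y x) (Z x)) x u =
      fderiv ℝ G (F x) (fderiv ℝ F x u) (Y x) (Z x) + G (F x) (fderiv ℝ Y x u) (Z x)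
        + G (F x) (Y x) (fderiv ℝ Z x u) := by
  have h := fderiv_clm_apply₂ (c := fun x ↦ G (F x)) (hG.comp x hF) hY hZ u
  have hcomp : fderiv ℝ (fun x ↦ G (F x)) x = fderiv ℝ G (F x) ∘L fderiv ℝ F x :=
    fderiv_comp x hG hF
  rw [h, hcomp]
  rfl

theorem fderiv_apply_const {A : X → V →L[ℝ] W} {x : X} (hA : DifferentiableAt ℝ A x) (v : V)
    (u : X) : fderiv ℝ (fun x ↦ A x v) x u = fderiv ℝ A x u v := by
  rw [fderiv_clm_apply hA (differentiableAt_const v)]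
  simp

end calculus

/-! ### The Levi-Civita connection in coordinates -/

section metric

variable {V : Type*} [NormedAddCommGroup V] [NormedSpace ℝ V]
  {G : V → V →L[ℝ] V →L[ℝ] ℝ} {y : V}

theorem isInvertible_of_nondegenerate [FiniteDimensional ℝ V] {B : V →L[ℝ] V →L[ℝ] ℝ}
    (hB : ∀ v, (∀ w, B v w = 0) → v = 0) : B.IsInvertible := by
  have hinj : Function.Injective B.toLinearMap := by
    rw [← LinearMap.ker_eq_bot, LinearMap.ker_eq_bot']
    intro v hv
    refine hB v fun w ↦ ?_
    have : B v = 0 := hv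
    simp [this]
  have hdim : Module.finrank ℝ V = Module.finrank ℝ (V →L[ℝ] ℝ) := by
    rw [← (LinearMap.toContinuousLinearMap (𝕜 := ℝ) (E := V) (F' := ℝ)).finrank_eq]
    exact (Subspace.dual_finrank_eq (K := ℝ) (V := V)).symm
  have : FiniteDimensional ℝ (V →L[ℝ] ℝ) :=
    (LinearMap.toContinuousLinearMap (𝕜 := ℝ) (E := V) (F' := ℝ)).finiteDimensional
  exact ⟨(LinearEquiv.ofInjectiveOfFinrankEq B.toLinearMap hinj hdim).toContinuousLinearEquiv,
    by ext; rfl⟩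

theorem eq_of_forall_apply_eq {B : V →L[ℝ] V →L[ℝ] ℝ} (hB : B.IsInvertible) {v v' : V}
    (h : ∀ w, B v w = B v' w) : v = v' := by
  obtain ⟨e, rfl⟩ := hB
  exact e.injective (ContinuousLinearMap.ext h)

theorem fderiv_symm (hG : DifferentiableAt ℝ G y) (hs : ∀ᶠ y in 𝓝 y, ∀ v w, G y v w = G y w v)
    (u v w : V) : fderiv ℝ G y u v w = fderiv ℝ G y u w v := by
  have h (v w : V) : fderiv ℝ (fun y ↦ G y v w) y u = fderiv ℝ G y u v w := by
    simpa using fderiv_clm_apply₂ hG (differentiableAt_const v) (differentiableAt_const w) u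
  have h' : (fun y ↦ G y v w) =ᶠ[𝓝 y] fun y ↦ G y w v := hs.mono fun y hy ↦ hy v w
  rw [← h, ← h, h'.fderiv_eq]

theorem christoffelFirst_symm (hG : DifferentiableAt ℝ G y)
    (hs : ∀ᶠ y in 𝓝 y, ∀ v w, G y v w = G y w v) (u v w : V) :
    christoffelFirst G y u v w = christoffelFirst G y v u w := by
  rw [christoffelFirst_apply, christoffelFirst_apply, fderiv_symm hG hs w u v]
  ring

theorem christoffel_symm (hG : DifferentiableAt ℝ G y)
    (hs : ∀ᶠ y in 𝓝 y, ∀ v w, G y v w = G y w v) (hi : (G y).IsInvertible) (u v : V) :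
    christoffel G y u v = christoffel G y v u := by
  refine eq_of_forall_apply_eq hi fun w ↦ ?_
  rw [apply_christoffel _ _ hi, apply_christoffel _ _ hi, christoffelFirst_symm hG hs]

/-- This is `∇G = 0`. In the sum of the two first-kind symbols the derivatives in the directions `v`
and `w` cancel by symmetry of `G`, and the two halves of `∂_u G(v, w)` add up. -/
theorem fderiv_eq_christoffel (hG : DifferentiableAt ℝ G y)
    (hs : ∀ᶠ y in 𝓝 y, ∀ v w, G y v w = G y w v) (hi : (G y).IsInvertible) (u v w : V) :
    fderiv ℝ G y u v w = G y (christoffel G y u v) w + G y v (christoffel G y u w) := by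
  rw [hs.self_of_nhds v, apply_christoffel _ _ hi, apply_christoffel _ _ hi,
    christoffelFirst_apply, christoffelFirst_apply, fderiv_symm hG hs u w v,
    fderiv_symm hG hs v u w, fderiv_symm hG hs w u v]
  ring

theorem contDiffAt_christoffel [CompleteSpace V] {k : ℕ∞} (hG : ContDiffAt ℝ (k + 1) G y)
    (hi : (G y).IsInvertible) :
    ContDiffAt ℝ k (christoffel G) y := by
  have hdG : ContDiffAt ℝ k (fderiv ℝ G) y := hG.fderiv_right le_rfl
  have hflip : ContDiffAt ℝ k (fun y ↦ (fderiv ℝ G y).flip) y :=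
    (ContinuousLinearMap.flipₗᵢ ℝ V V (V →L[ℝ] ℝ)).contDiff.contDiffAt.comp y hdG
  have hfirst : ContDiffAt ℝ k (christoffelFirst G) y :=
    (((hdG.add hflip).sub (contDiffAt_const.clm_comp hflip)).const_smul (1 / 2 : ℝ))
  have hinv : ContDiffAt ℝ k (fun y ↦ (G y).inverse) y :=
    (hi.contDiffAt_map_inverse).comp y (hG.of_le (by exact_mod_cast le_self_add))
  exact ((ContinuousLinearMap.compL ℝ V (V →L[ℝ] ℝ) V).contDiff.contDiffAt.comp y hinv).clm_comp
    hfirst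

/-- The transformation law of the Christoffel symbols under a change of coordinates `ψ`. -/
theorem fderiv_christoffel_pullback {V' : Type*} [NormedAddCommGroup V'] [NormedSpace ℝ V']
    {G' : V' → V' →L[ℝ] V' →L[ℝ] ℝ} {ψ : V' → V} {z : V'}
    (hψ : ContDiffAt ℝ 2 ψ z) (hG : DifferentiableAt ℝ G (ψ z))
    (hs : ∀ᶠ y in 𝓝 (ψ z), ∀ v w, G y v w = G y w v)
    (hG' : ∀ᶠ y in 𝓝 z, ∀ v w, G' y v w = G (ψ y) (fderiv ℝ ψ y v) (fderiv ℝ ψ y w))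
    (hdG' : DifferentiableAt ℝ G' z)
    (hi : (G (ψ z)).IsInvertible) (hi' : (G' z).IsInvertible)
    (hψs : Function.Surjective (fderiv ℝ ψ z)) (u v : V') :
    fderiv ℝ ψ z (christoffel G' z u v) =
      fderiv ℝ (fderiv ℝ ψ) z u v + christoffel G (ψ z) (fderiv ℝ ψ z u) (fderiv ℝ ψ z v) := by
  have hψd : DifferentiableAt ℝ ψ z := hψ.differentiableAt (by norm_num)
  have hψdd : DifferentiableAt ℝ (fderiv ℝ ψ) z :=
    (hψ.fderiv_right (m := 1) (by norm_num)).differentiableAt (by norm_num)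
  have hsymm := hψ.isSymmSndFDerivAt (by simp)
  have key (w a b : V') : fderiv ℝ G' z w a b =
      fderiv ℝ G (ψ z) (fderiv ℝ ψ z w) (fderiv ℝ ψ z a) (fderiv ℝ ψ z b)
        + G (ψ z) (fderiv ℝ (fderiv ℝ ψ) z w a) (fderiv ℝ ψ z b)
        + G (ψ z) (fderiv ℝ ψ z a) (fderiv ℝ (fderiv ℝ ψ) z w b) := by
    have h1 : fderiv ℝ (fun y ↦ G' y a b) z w = fderiv ℝ G' z w a b := by
      simpa using fderiv_clm_apply₂ hdG' (differentiableAt_const a) (differentiableAt_const b) w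
    have h2 : (fun y ↦ G' y a b) =ᶠ[𝓝 z] fun y ↦ G (ψ y) (fderiv ℝ ψ y a) (fderiv ℝ ψ y b) :=
      hG'.mono fun y hy ↦ hy a b
    rw [← h1, h2.fderiv_eq, fderiv_comp_clm_apply₂ hG hψd
      (hψdd.clm_apply (differentiableAt_const a)) (hψdd.clm_apply (differentiableAt_const b)),
      fderiv_apply_const hψdd, fderiv_apply_const hψdd]
  -- Pairing with `G` leaves only first-kind symbols, and surjectivity of `dψ` allows testing on its
  -- image. By `key` six terms contain `D²ψ`; symmetry cancels four, and the other two are equal and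
  -- give the inhomogeneous term.
  refine eq_of_forall_apply_eq hi fun w' ↦ ?_
  obtain ⟨w, rfl⟩ := hψs w'
  rw [← hG'.self_of_nhds, apply_christoffel _ _ hi', christoffelFirst_apply, key, key, key,
    map_add, add_apply, apply_christoffel _ _ hi, christoffelFirst_apply,
    hsymm.eq v u, hsymm.eq w u, hsymm.eq w v,
    hs.self_of_nhds (fderiv ℝ ψ z u) (fderiv ℝ (fderiv ℝ ψ) z v w),
    hs.self_of_nhds (fderiv ℝ ψ z v) (fderiv ℝ (fderiv ℝ ψ) z u w)]
  ring

end metric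

/-! ### Covariant differentiation along a map -/

section along

variable {X V : Type*} [NormedAddCommGroup X] [NormedSpace ℝ X]
  [NormedAddCommGroup V] [NormedSpace ℝ V]
  {G : V → V →L[ℝ] V →L[ℝ] ℝ} {F : X → V} {x : X}

/-- The Levi-Civita covariant derivative of a field `Y` along a map `F`, in coordinates. -/
def covDeriv (G : V → V →L[ℝ] V →L[ℝ] ℝ) (F Y : X → V) (x : X) : X →L[ℝ] V :=
  fderiv ℝ Y x + (christoffel G (F x)).flip (Y x) ∘L fderiv ℝ F x

theorem covDeriv_apply (F Y : X → V) (x u : X) :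
    covDeriv G F Y x u = fderiv ℝ Y x u + christoffel G (F x) (fderiv ℝ F x u) (Y x) := rfl

theorem covDeriv_congr {Y Y' : X → V} (h : Y =ᶠ[𝓝 x] Y') :
    covDeriv G F Y x = covDeriv G F Y' x := by
  rw [covDeriv, covDeriv, h.fderiv_eq, h.self_of_nhds]

/-- The covariant Hessian of a map `F`, in coordinates. -/
def covHessian (G : V → V →L[ℝ] V →L[ℝ] ℝ) (F : X → V) (x u v : X) : V :=
  fderiv ℝ (fderiv ℝ F) x u v + christoffel G (F x) (fderiv ℝ F x u) (fderiv ℝ F x v)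

theorem covDeriv_fderiv_apply (hF : DifferentiableAt ℝ (fderiv ℝ F) x) {Y : X → X}
    (hY : DifferentiableAt ℝ Y x) (u : X) :
    covDeriv G F (fun x ↦ fderiv ℝ F x (Y x)) x u =
      covHessian G F x u (Y x) + fderiv ℝ F x (fderiv ℝ Y x u) := by
  rw [covDeriv_apply, fderiv_clm_apply hF hY, covHessian]
  simp
  abel

theorem covDeriv_fderiv_const (hF : DifferentiableAt ℝ (fderiv ℝ F) x) (u v : X) :
    covDeriv G F (fun x ↦ fderiv ℝ F x v) x u = covHessian G F x u v := by
  simpa using covDeriv_fderiv_apply (G := G) hF (differentiableAt_const v) u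

theorem covHessian_symm (hF : ContDiffAt ℝ 2 F x) (hG : DifferentiableAt ℝ G (F x))
    (hs : ∀ᶠ y in 𝓝 (F x), ∀ v w, G y v w = G y w v) (hi : (G (F x)).IsInvertible) (u v : X) :
    covHessian G F x u v = covHessian G F x v u := by
  rw [covHessian, covHessian, (hF.isSymmSndFDerivAt (by simp)).eq, christoffel_symm hG hs hi]

/-- Metric compatibility of the Levi-Civita connection along a map. -/
theorem fderiv_metric_apply (hF : DifferentiableAt ℝ F x) (hG : DifferentiableAt ℝ G (F x))
    (hs : ∀ᶠ y in 𝓝 (F x), ∀ v w, G y v w = G y w v) (hi : (G (F x)).IsInvertible)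
    {Y Z : X → V} (hY : DifferentiableAt ℝ Y x) (hZ : DifferentiableAt ℝ Z x) (u : X) :
    fderiv ℝ (fun x ↦ G (F x) (Y x) (Z x)) x u =
      G (F x) (covDeriv G F Y x u) (Z x) + G (F x) (Y x) (covDeriv G F Z x u) := by
  rw [fderiv_comp_clm_apply₂ hG hF hY hZ, fderiv_eq_christoffel hG hs hi, covDeriv_apply,
    covDeriv_apply]
  simp
  ring

/-- Covariant derivatives along a map commute up to curvature. -/
theorem covDeriv_covDeriv_sub (hF : ContDiffAt ℝ 2 F x)
    (hΓ : DifferentiableAt ℝ (christoffel G) (F x)) {Y : X → V} (hY : ContDiffAt ℝ 2 Y x)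
    (u v : X) :
    covDeriv G F (fun x ↦ covDeriv G F Y x v) x u -
        covDeriv G F (fun x ↦ covDeriv G F Y x u) x v =
      curvature G (F x) (fderiv ℝ F x u) (fderiv ℝ F x v) (Y x) := by
  have hFd : DifferentiableAt ℝ F x := hF.differentiableAt (by norm_num)
  have hFdd : DifferentiableAt ℝ (fderiv ℝ F) x :=
    (hF.fderiv_right (m := 1) (by norm_num)).differentiableAt (by norm_num)
  have hYd : DifferentiableAt ℝ Y x := hY.differentiableAt (by norm_num)
  have hYdd : DifferentiableAt ℝ (fderiv ℝ Y) x :=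
    (hY.fderiv_right (m := 1) (by norm_num)).differentiableAt (by norm_num)
  have hΓF : DifferentiableAt ℝ (fun x ↦ christoffel G (F x)) x := hΓ.comp x hFd
  have hcomp : fderiv ℝ (fun x ↦ christoffel G (F x)) x =
      fderiv ℝ (christoffel G) (F x) ∘L fderiv ℝ F x := fderiv_comp x hΓ hFd
  have key (u v : X) : fderiv ℝ (fun x ↦ covDeriv G F Y x v) x u =
      fderiv ℝ (fderiv ℝ Y) x u v +
        (fderiv ℝ (christoffel G) (F x) (fderiv ℝ F x u) (fderiv ℝ F x v) (Y x)
          + christoffel G (F x) (fderiv ℝ (fderiv ℝ F) x u v) (Y x)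
          + christoffel G (F x) (fderiv ℝ F x v) (fderiv ℝ Y x u)) := by
    have hFv : DifferentiableAt ℝ (fun x ↦ fderiv ℝ F x v) x :=
      hFdd.clm_apply (differentiableAt_const v)
    have hYv : DifferentiableAt ℝ (fun x ↦ fderiv ℝ Y x v) x :=
      hYdd.clm_apply (differentiableAt_const v)
    have e : (fun x ↦ covDeriv G F Y x v) =
      fun x ↦ fderiv ℝ Y x v + christoffel G (F x) (fderiv ℝ F x v) (Y x) := rfl
    rw [e, fderiv_fun_add hYv ((hΓF.clm_apply hFv).clm_apply hYd), add_apply,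
      fderiv_clm_apply₂ hΓF hFv hYd, fderiv_apply_const hYdd, fderiv_apply_const hFdd, hcomp]
    rfl
  -- The terms with `D²Y` and `D²F` are symmetric in `u`, `v`, and the terms pairing `Γ` with a
  -- first derivative of `Y` cancel crosswise. What survives is `dΓ` and the quadratic terms in `Γ`,
  -- that is, the curvature.
  rw [covDeriv_apply F (fun x ↦ covDeriv G F Y x v), covDeriv_apply F (fun x ↦ covDeriv G F Y x u),
    key, key, covDeriv_apply F Y, covDeriv_apply F Y, curvature,
    (hF.isSymmSndFDerivAt (by simp)).eq v u, (hY.isSymmSndFDerivAt (by simp)).eq v u]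
  simp only [map_add]
  abel

/-- Covariant derivatives along a map do not depend on the coordinates. -/
theorem covDeriv_pullback {V' : Type*} [NormedAddCommGroup V'] [NormedSpace ℝ V']
    {G' : V' → V' →L[ℝ] V' →L[ℝ] ℝ} {ψ : V' → V} {F' Y' : X → V'} {Y : X → V}
    (hψ : ContDiffAt ℝ 2 ψ (F' x)) (hG : DifferentiableAt ℝ G (ψ (F' x)))
    (hs : ∀ᶠ y in 𝓝 (ψ (F' x)), ∀ v w, G y v w = G y w v)
    (hG' : ∀ᶠ y in 𝓝 (F' x), ∀ v w, G' y v w = G (ψ y) (fderiv ℝ ψ y v) (fderiv ℝ ψ y w))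
    (hdG' : DifferentiableAt ℝ G' (F' x))
    (hi : (G (ψ (F' x))).IsInvertible) (hi' : (G' (F' x)).IsInvertible)
    (hψs : Function.Surjective (fderiv ℝ ψ (F' x)))
    (hF' : DifferentiableAt ℝ F' x) (hY' : DifferentiableAt ℝ Y' x)
    (hF : F =ᶠ[𝓝 x] fun x ↦ ψ (F' x)) (hY : Y =ᶠ[𝓝 x] fun x ↦ fderiv ℝ ψ (F' x) (Y' x)) (u : X) :
    covDeriv G F Y x u = fderiv ℝ ψ (F' x) (covDeriv G' F' Y' x u) := by
  have hψd : DifferentiableAt ℝ ψ (F' x) := hψ.differentiableAt (by norm_num)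
  have hψdd : DifferentiableAt ℝ (fderiv ℝ ψ) (F' x) :=
    (hψ.fderiv_right (m := 1) (by norm_num)).differentiableAt (by norm_num)
  have h1 : fderiv ℝ (fun x ↦ ψ (F' x)) x = fderiv ℝ ψ (F' x) ∘L fderiv ℝ F' x :=
    fderiv_comp x hψd hF'
  have h3 : DifferentiableAt ℝ (fun x ↦ fderiv ℝ ψ (F' x)) x := hψdd.comp x hF'
  have h2 : fderiv ℝ (fun x ↦ fderiv ℝ ψ (F' x)) x =
      fderiv ℝ (fderiv ℝ ψ) (F' x) ∘L fderiv ℝ F' x :=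
    fderiv_comp x hψdd hF'
  -- Differentiating `dψ(Y')` produces `D²ψ(dF'(u), Y')`, which is the inhomogeneous term in the
  -- transformation law of the Christoffel symbols.
  rw [covDeriv_apply, covDeriv_apply, map_add,
    fderiv_christoffel_pullback hψ hG hs hG' hdG' hi hi' hψs, hF.fderiv_eq, hF.self_of_nhds,
    hY.fderiv_eq, hY.self_of_nhds, h1, fderiv_clm_apply h3 hY', h2]
  simp
  abel

end along

end LocalMetric

/-! ### Derivatives of determinants -/

namespace Matrix

variable {ι X : Type*} [Fintype ι] [DecidableEq ι] [NormedAddCommGroup X] [NormedSpace ℝ X]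

/-- Jacobi's formula for the derivative of a determinant. -/
theorem hasFDerivAt_det {A : X → Matrix ι ι ℝ} {A' : ι → ι → X →L[ℝ] ℝ} {x : X}
    (hA : ∀ i j, HasFDerivAt (fun x ↦ A x i j) (A' i j) x) :
    HasFDerivAt (fun x ↦ (A x).det) (∑ j, ∑ i, (A x).adjugate j i • A' i j) x := by
  have h : HasFDerivAt (fun x ↦ ∑ σ : Equiv.Perm ι, (Equiv.Perm.sign σ : ℤ) • ∏ i, A x (σ i) i)
      (∑ σ : Equiv.Perm ι, (Equiv.Perm.sign σ : ℤ) •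
        ∑ i, (∏ j ∈ Finset.univ.erase i, A x (σ j) j) • A' (σ i) i) x :=
    HasFDerivAt.fun_sum fun σ _ ↦
      (HasFDerivAt.finsetProd fun i _ ↦ hA (σ i) i).const_smul (Equiv.Perm.sign σ : ℤ)
  have e : (fun x ↦ (A x).det) =
      fun x ↦ ∑ σ : Equiv.Perm ι, (Equiv.Perm.sign σ : ℤ) • ∏ i, A x (σ i) i := by
    funext x
    simp [det_apply, Units.smul_def]
  rw [e]
  convert h using 1
  ext u
  -- Cramer's rule: differentiating the determinant amounts to replacing one column at a time by its
  -- derivative.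
  have hcol (j : ι) : ∑ i, (A x).adjugate j i * A' i j u =
      ((A x).updateCol j fun i ↦ A' i j u).det := by
    rw [← cramer_apply, cramer_eq_adjugate_mulVec]
    rfl
  simp only [_root_.sum_apply, _root_.smul_apply, smul_eq_mul, hcol]
  simp only [det_apply]
  rw [Finset.sum_comm]
  refine Finset.sum_congr rfl fun σ _ ↦ ?_
  rw [Finset.smul_sum]
  refine Finset.sum_congr rfl fun i _ ↦ ?_
  rw [← Finset.mul_prod_erase _ _ (Finset.mem_univ i), updateCol_self, mul_comm]
  congr 2
  exact Finset.prod_congr rfl fun j hj ↦ updateCol_ne (Finset.ne_of_mem_erase hj)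

/-- For a Gram matrix `H` and a connection matrix `c`, the derivative of `H` is the covariant part
`T` plus `cᵀH + Hc`. As `adj(H) H = det H`, the correction only contributes `2 tr c` times the
determinant, a multiple common to both fundamental forms. -/
theorem trace_adjugate_mul_transpose_mul_add (H c T : Matrix ι ι ℝ) :
    (H.adjugate * (T + (cᵀ * H + H * c))).trace =
      (H.adjugate * T).trace + 2 * H.det * c.trace := by
  rw [mul_add, mul_add, trace_add, trace_add, ← mul_assoc, ← mul_assoc, trace_mul_comm _ H,
    ← mul_assoc, mul_adjugate, adjugate_mul]
  simp
  ring

end Matrix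

/-! ### Hypersurfaces with a normal field of constant norm, in coordinates -/

namespace LocalMetric

open Filter Topology

variable {X V : Type*} [NormedAddCommGroup X] [NormedSpace ℝ X]
  [NormedAddCommGroup V] [NormedSpace ℝ V]

/-- A map `F` between vector spaces, given with a metric `G` near its image and a normal field `E`
of constant norm. -/
structure IsNormalField (G : V → V →L[ℝ] V →L[ℝ] ℝ) (F E : X → V) (ε : ℝ) (U : Set X) : Prop where
  isOpen : IsOpen U
  contDiffAt_map {x : X} (hx : x ∈ U) : ContDiffAt ℝ ∞ F x
  contDiffAt_metric {x : X} (hx : x ∈ U) : ContDiffAt ℝ ∞ G (F x)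
  symm {x : X} (hx : x ∈ U) : ∀ᶠ y in 𝓝 (F x), ∀ v w, G y v w = G y w v
  isInvertible {x : X} (hx : x ∈ U) : (G (F x)).IsInvertible
  contDiffAt_normal {x : X} (hx : x ∈ U) : ContDiffAt ℝ ∞ E x
  orthogonal {x : X} (hx : x ∈ U) (u : X) : G (F x) (E x) (fderiv ℝ F x u) = 0
  norm {x : X} (hx : x ∈ U) : G (F x) (E x) (E x) = ε

/-- The second fundamental form in coordinates, with respect to a normal field `E` with
`G(E, E) = ε`. -/
def secondForm (G : V → V →L[ℝ] V →L[ℝ] ℝ) (F E : X → V) (ε : ℝ) (x u v : X) : ℝ :=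
  ε * G (F x) (E x) (covHessian G F x u v)

/-- The first fundamental form in coordinates. -/
def firstForm (G : V → V →L[ℝ] V →L[ℝ] ℝ) (F : X → V) (x u v : X) : ℝ :=
  G (F x) (fderiv ℝ F x u) (fderiv ℝ F x v)

theorem covHessian_add_smul_left {G : V → V →L[ℝ] V →L[ℝ] ℝ} {F : X → V} (x u u' v : X) (c : ℝ) :
    covHessian G F x (c • u + u') v = c • covHessian G F x u v + covHessian G F x u' v := by
  simp only [covHessian, map_add, map_smul, add_apply, smul_apply,
    smul_add]
  abel

theorem covHessian_add_smul_right {G : V → V →L[ℝ] V →L[ℝ] ℝ} {F : X → V} (x u v v' : X) (c : ℝ) :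
    covHessian G F x u (c • v + v') = c • covHessian G F x u v + covHessian G F x u v' := by
  simp only [covHessian, map_add, map_smul, smul_add]
  abel

/-- The second fundamental form as a bilinear map. -/
def secondFormBilin (G : V → V →L[ℝ] V →L[ℝ] ℝ) (F E : X → V) (ε : ℝ) (x : X) :
    X →ₗ[ℝ] X →ₗ[ℝ] ℝ :=
  LinearMap.mk₂ ℝ (secondForm G F E ε x)
    (fun u u' v ↦ by
      have := covHessian_add_smul_left (G := G) (F := F) x u u' v 1
      rw [one_smul, one_smul] at this
      simp [secondForm, this, mul_add])
    (fun c u v ↦ by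
      have h0 := covHessian_add_smul_left (G := G) (F := F) x 0 0 v 1
      have := covHessian_add_smul_left (G := G) (F := F) x u 0 v c
      simp only [one_smul, add_zero, left_eq_add] at h0
      rw [add_zero, h0, add_zero] at this
      simp [secondForm, this]
      ring)
    (fun u v v' ↦ by
      have := covHessian_add_smul_right (G := G) (F := F) x u v v' 1
      rw [one_smul, one_smul] at this
      simp [secondForm, this, mul_add])
    (fun c u v ↦ by
      have h0 := covHessian_add_smul_right (G := G) (F := F) x u 0 0 1
      have := covHessian_add_smul_right (G := G) (F := F) x u v 0 c
      simp only [one_smul, add_zero, left_eq_add] at h0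
      rw [add_zero, h0, add_zero] at this
      simp [secondForm, this]
      ring)

theorem secondFormBilin_apply (G : V → V →L[ℝ] V →L[ℝ] ℝ) (F E : X → V) (ε : ℝ) (x u v : X) :
    secondFormBilin G F E ε x u v = secondForm G F E ε x u v := rfl

/-- The first fundamental form as a bilinear map. -/
def firstFormBilin (G : V → V →L[ℝ] V →L[ℝ] ℝ) (F : X → V) (x : X) : X →ₗ[ℝ] X →ₗ[ℝ] ℝ :=
  LinearMap.mk₂ ℝ (firstForm G F x) (by simp [firstForm]) (by simp [firstForm])
    (by simp [firstForm]) (by simp [firstForm])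

/-- The covariant derivative of the second fundamental form, in coordinates, for the connection
with Christoffel symbols `C`. -/
def covDerivSecondForm (G : V → V →L[ℝ] V →L[ℝ] ℝ) (F E : X → V) (ε : ℝ) (x : X) (C : X → X → X)
    (u v w : X) : ℝ :=
  fderiv ℝ (fun x ↦ secondForm G F E ε x v w) x u - secondForm G F E ε x (C u v) w -
    secondForm G F E ε x v (C u w)

namespace IsNormalField

variable {G : V → V →L[ℝ] V →L[ℝ] ℝ} {F E : X → V} {ε : ℝ} {U : Set X} {x : X}

theorem differentiableAt_metric (h : IsNormalField G F E ε U) (hx : x ∈ U) :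
    DifferentiableAt ℝ G (F x) :=
  (h.contDiffAt_metric hx).differentiableAt (by simp)

theorem differentiableAt_map (h : IsNormalField G F E ε U) (hx : x ∈ U) :
    DifferentiableAt ℝ F x :=
  (h.contDiffAt_map hx).differentiableAt (by simp)

theorem differentiableAt_normal (h : IsNormalField G F E ε U) (hx : x ∈ U) :
    DifferentiableAt ℝ E x :=
  (h.contDiffAt_normal hx).differentiableAt (by simp)

theorem contDiffAt_fderiv (h : IsNormalField G F E ε U) (hx : x ∈ U) :
    ContDiffAt ℝ ∞ (fderiv ℝ F) x :=
  (h.contDiffAt_map hx).fderiv_right (by simp)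

theorem differentiableAt_fderiv (h : IsNormalField G F E ε U) (hx : x ∈ U) :
    DifferentiableAt ℝ (fderiv ℝ F) x :=
  (h.contDiffAt_fderiv hx).differentiableAt (by simp)

theorem differentiableAt_fderiv_apply (h : IsNormalField G F E ε U) (hx : x ∈ U) (v : X) :
    DifferentiableAt ℝ (fun x ↦ fderiv ℝ F x v) x :=
  (h.differentiableAt_fderiv hx).clm_apply (differentiableAt_const v)

theorem differentiableAt_christoffel [CompleteSpace V] (h : IsNormalField G F E ε U) (hx : x ∈ U) :
    DifferentiableAt ℝ (christoffel G) (F x) :=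
  (contDiffAt_christoffel (k := 1) ((h.contDiffAt_metric hx).of_le (mod_cast le_top))
    (h.isInvertible hx)).differentiableAt (by simp)

theorem differentiableAt_covHessian [CompleteSpace V] (h : IsNormalField G F E ε U) (hx : x ∈ U)
    (u v : X) : DifferentiableAt ℝ (fun x ↦ covHessian G F x u v) x := by
  have h1 : DifferentiableAt ℝ (fun x ↦ fderiv ℝ (fderiv ℝ F) x u v) x :=
    ((((h.contDiffAt_fderiv hx).fderiv_right (m := ∞) (by simp)).differentiableAt
      (by simp)).clm_apply (differentiableAt_const u)).clm_apply (differentiableAt_const v)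
  have h2 : DifferentiableAt ℝ (fun x ↦ christoffel G (F x)) x :=
    (h.differentiableAt_christoffel hx).comp x (h.differentiableAt_map hx)
  exact h1.add ((h2.clm_apply (h.differentiableAt_fderiv_apply hx u)).clm_apply
    (h.differentiableAt_fderiv_apply hx v))

theorem differentiableAt_secondForm [CompleteSpace V] (h : IsNormalField G F E ε U) (hx : x ∈ U)
    (u v : X) : DifferentiableAt ℝ (fun x ↦ secondForm G F E ε x u v) x := by
  have h2 : DifferentiableAt ℝ (fun x ↦ G (F x)) x :=
    (h.differentiableAt_metric hx).comp x (h.differentiableAt_map hx)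
  exact (((h2.clm_apply (h.differentiableAt_normal hx)).clm_apply
    (h.differentiableAt_covHessian hx u v)).const_mul ε)

theorem differentiableAt_firstForm (h : IsNormalField G F E ε U) (hx : x ∈ U)
    (u v : X) : DifferentiableAt ℝ (fun x ↦ firstForm G F x u v) x := by
  have h2 : DifferentiableAt ℝ (fun x ↦ G (F x)) x :=
    (h.differentiableAt_metric hx).comp x (h.differentiableAt_map hx)
  exact ((h2.clm_apply (h.differentiableAt_fderiv_apply hx u)).clm_apply
    (h.differentiableAt_fderiv_apply hx v))

theorem covHessian_symm (h : IsNormalField G F E ε U) (hx : x ∈ U) (u v : X) :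
    covHessian G F x u v = covHessian G F x v u :=
  LocalMetric.covHessian_symm ((h.contDiffAt_map hx).of_le (by norm_cast))
    (h.differentiableAt_metric hx) (h.symm hx) (h.isInvertible hx) u v

theorem secondForm_symm (h : IsNormalField G F E ε U) (hx : x ∈ U) (u v : X) :
    secondForm G F E ε x u v = secondForm G F E ε x v u := by
  rw [secondForm, secondForm, h.covHessian_symm hx]

/-- Differentiate `G(E, E) = ε`. -/
theorem apply_covDeriv_normal (h : IsNormalField G F E ε U) (hx : x ∈ U) (u : X) :
    G (F x) (covDeriv G F E x u) (E x) = 0 := by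
  have h1 := fderiv_metric_apply (h.differentiableAt_map hx) (h.differentiableAt_metric hx)
    (h.symm hx) (h.isInvertible hx) (h.differentiableAt_normal hx) (h.differentiableAt_normal hx) u
  have h2 : (fun x ↦ G (F x) (E x) (E x)) =ᶠ[𝓝 x] fun _ ↦ ε := by
    filter_upwards [h.isOpen.mem_nhds hx] with x' hx' using h.norm hx'
  rw [h2.fderiv_eq, (h.symm hx).self_of_nhds (E x)] at h1
  simp at h1
  linarith

/-- The Weingarten relation, from differentiating `G(E, dF(v)) = 0`. -/
theorem apply_covDeriv_tangent (h : IsNormalField G F E ε U) (hx : x ∈ U) (u v : X) :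
    G (F x) (covDeriv G F E x u) (fderiv ℝ F x v) = - G (F x) (E x) (covHessian G F x u v) := by
  have h1 := fderiv_metric_apply (h.differentiableAt_map hx) (h.differentiableAt_metric hx)
    (h.symm hx) (h.isInvertible hx) (h.differentiableAt_normal hx)
    (h.differentiableAt_fderiv_apply hx v) u
  have h2 : (fun x ↦ G (F x) (E x) (fderiv ℝ F x v)) =ᶠ[𝓝 x] fun _ ↦ 0 := by
    filter_upwards [h.isOpen.mem_nhds hx] with x' hx' using h.orthogonal hx' v
  rw [h2.fderiv_eq, covDeriv_fderiv_const (h.differentiableAt_fderiv hx)] at h1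
  simp at h1
  linarith

/-- The hypothesis `hC` is the Gauss formula: `C` is the tangential part of the covariant Hessian.
The normal part is orthogonal to tangent vectors, so the connection `C` is metric for the first
fundamental form. -/
theorem fderiv_firstForm (h : IsNormalField G F E ε U) (hx : x ∈ U) {C : X → X → X}
    (hC : ∀ u v, fderiv ℝ F x (C u v) + secondForm G F E ε x u v • E x = covHessian G F x u v)
    (u v w : X) :
    fderiv ℝ (fun x ↦ firstForm G F x v w) x u =
      firstForm G F x (C u v) w + firstForm G F x v (C u w) := by
  have h1 := fderiv_metric_apply (h.differentiableAt_map hx) (h.differentiableAt_metric hx)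
    (h.symm hx) (h.isInvertible hx) (h.differentiableAt_fderiv_apply hx v)
    (h.differentiableAt_fderiv_apply hx w) u
  simp only [firstForm]
  rw [h1, covDeriv_fderiv_const (h.differentiableAt_fderiv hx),
    covDeriv_fderiv_const (h.differentiableAt_fderiv hx), ← hC, ← hC]
  simp [h.orthogonal hx, (h.symm hx).self_of_nhds (fderiv ℝ F x v) (E x)]

theorem covDerivSecondForm_symm (h : IsNormalField G F E ε U) (hx : x ∈ U) {C : X → X → X}
    (u v w : X) :
    covDerivSecondForm G F E ε x C u v w = covDerivSecondForm G F E ε x C u w v := by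
  have h1 : (fun x ↦ secondForm G F E ε x v w) =ᶠ[𝓝 x] fun x ↦ secondForm G F E ε x w v := by
    filter_upwards [h.isOpen.mem_nhds hx] with x' hx' using h.secondForm_symm hx' v w
  rw [covDerivSecondForm, covDerivSecondForm, h1.fderiv_eq, h.secondForm_symm hx (C u v),
    h.secondForm_symm hx v]
  ring

/-- The Codazzi equation, when the curvature has no normal component. -/
theorem covDerivSecondForm_comm [CompleteSpace V] (h : IsNormalField G F E ε U) (hx : x ∈ U)
    (hinj : Function.Injective (fderiv ℝ F x)) {C : X → X → X}
    (hC : ∀ u v, fderiv ℝ F x (C u v) + secondForm G F E ε x u v • E x = covHessian G F x u v)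
    (hR : ∀ u v w, G (F x) (E x)
      (curvature G (F x) (fderiv ℝ F x u) (fderiv ℝ F x v) (fderiv ℝ F x w)) = 0)
    (u v w : X) :
    covDerivSecondForm G F E ε x C u v w = covDerivSecondForm G F E ε x C v u w := by
  -- The induced connection is torsion-free: the Hessian and its normal part are symmetric, and `dF`
  -- is injective.
  have hCs : C u v = C v u := by
    refine hinj (add_right_cancel (b := secondForm G F E ε x u v • E x) ?_)
    rw [hC, h.secondForm_symm hx u v, hC, h.covHessian_symm hx]
  -- In the derivative of `ε G(E, Hess F(v, w))`, the factor `∇̂_u E` is orthogonal to `E` and only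
  -- sees the tangential part `C v w`. By the Weingarten relation it contributes `-h(u, C v w)`.
  have key (u v : X) : fderiv ℝ (fun x ↦ secondForm G F E ε x v w) x u =
      ε * G (F x) (E x) (covDeriv G F (fun x ↦ covDeriv G F (fun x ↦ fderiv ℝ F x w) x v) x u)
        - secondForm G F E ε x u (C v w) := by
    have h1 := fderiv_metric_apply (h.differentiableAt_map hx) (h.differentiableAt_metric hx)
      (h.symm hx) (h.isInvertible hx) (h.differentiableAt_normal hx)
      (h.differentiableAt_covHessian hx v w) u
    have h2 : DifferentiableAt ℝ (fun x ↦ G (F x) (E x) (covHessian G F x v w)) x :=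
      ((((h.differentiableAt_metric hx).comp x (h.differentiableAt_map hx) :
        DifferentiableAt ℝ (fun x ↦ G (F x)) x).clm_apply
        (h.differentiableAt_normal hx)).clm_apply (h.differentiableAt_covHessian hx v w))
    have h3 : (fun x ↦ covHessian G F x v w) =ᶠ[𝓝 x]
        fun x ↦ covDeriv G F (fun x ↦ fderiv ℝ F x w) x v := by
      filter_upwards [h.isOpen.mem_nhds hx] with x' hx'
      rw [covDeriv_fderiv_const (h.differentiableAt_fderiv hx')]
    simp only [secondForm]
    rw [fderiv_const_mul h2, smul_apply, h1, covDeriv_congr h3, ← hC v w, map_add, map_smul,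
      h.apply_covDeriv_normal hx, h.apply_covDeriv_tangent hx]
    simp
    ring
  have hcomm := covDeriv_covDeriv_sub ((h.contDiffAt_map hx).of_le (by norm_cast))
    (h.differentiableAt_christoffel hx) (Y := fun x ↦ fderiv ℝ F x w)
    (((h.contDiffAt_fderiv hx).clm_apply contDiffAt_const).of_le (by norm_cast)) u v
  have hcomm' := congrArg (G (F x) (E x)) hcomm
  rw [hR, map_sub, sub_eq_zero] at hcomm'
  rw [covDerivSecondForm, covDerivSecondForm, key u v, key v u, hcomm', hCs]
  ring

/-- The logarithmic derivative of the Gauss-Kronecker curvature `k`, when the curvature has no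
normal component. -/
theorem hasFDerivAt_curvature {ι : Type*} [Fintype ι] [DecidableEq ι]
    [CompleteSpace V] (h : IsNormalField G F E ε U) (hx : x ∈ U)
    (b : Module.Basis ι ℝ X) {C : X → X → X}
    (hC : ∀ u v, fderiv ℝ F x (C u v) + secondForm G F E ε x u v • E x = covHessian G F x u v)
    {k : X → ℝ} {κ : ℝ}
    (hk : ∀ᶠ x in 𝓝 x, k x * (Matrix.of fun i j ↦ firstForm G F x (b i) (b j)).det =
      κ * (Matrix.of fun i j ↦ secondForm G F E ε x (b i) (b j)).det)
    (hI : (Matrix.of fun i j ↦ firstForm G F x (b i) (b j)).det ≠ 0)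
    (hH : (Matrix.of fun i j ↦ secondForm G F E ε x (b i) (b j)).det ≠ 0) :
    DifferentiableAt ℝ k x ∧ ∀ w, fderiv ℝ k x w = k x * ∑ i, ∑ j,
      (Matrix.of fun i j ↦ secondForm G F E ε x (b i) (b j))⁻¹ i j *
        covDerivSecondForm G F E ε x C w (b i) (b j) := by
  set A : X → Matrix ι ι ℝ := fun x ↦ Matrix.of fun i j ↦ firstForm G F x (b i) (b j) with hA
  set B : X → Matrix ι ι ℝ := fun x ↦ Matrix.of fun i j ↦ secondForm G F E ε x (b i) (b j) with hB
  have hdA := Matrix.hasFDerivAt_det (A := A) (x := x) fun i j ↦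
    (h.differentiableAt_firstForm hx (b i) (b j)).hasFDerivAt
  have hdB := Matrix.hasFDerivAt_det (A := B) (x := x) fun i j ↦
    (h.differentiableAt_secondForm hx (b i) (b j)).hasFDerivAt
  have hkd : DifferentiableAt ℝ k x := by
    have h1 : k =ᶠ[𝓝 x] fun x ↦ κ * (B x).det / (A x).det := by
      filter_upwards [hk, hdA.continuousAt.eventually_ne hI] with x' h1 h2
      rw [eq_div_iff h2, h1]
    have h2 : DifferentiableAt ℝ (fun x ↦ κ * (B x).det / (A x).det) x := by
      simp only [div_eq_mul_inv]
      exact (hdB.differentiableAt.const_mul κ).mul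
        ((differentiableAt_inv hI).comp x hdA.differentiableAt)
    exact h2.congr_of_eventuallyEq h1
  refine ⟨hkd, fun w ↦ ?_⟩
  set c : Matrix ι ι ℝ := Matrix.of fun l j ↦ b.repr (C w (b j)) l with hc
  set T : Matrix ι ι ℝ := Matrix.of fun i j ↦ covDerivSecondForm G F E ε x C w (b i) (b j) with hT
  -- `c` is the matrix of `C w` in the basis, so the connection terms of any bilinear form become
  -- `cᵀΦ + Φc`. This serves both fundamental forms.
  have expand (Φ : X →ₗ[ℝ] X →ₗ[ℝ] ℝ) (i j : ι) :
      Φ (C w (b i)) (b j) + Φ (b i) (C w (b j)) =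
        (c.transpose * (Matrix.of fun i j ↦ Φ (b i) (b j)) +
          (Matrix.of fun i j ↦ Φ (b i) (b j)) * c) i j := by
    rw [Matrix.add_apply, Matrix.mul_apply, Matrix.mul_apply]
    congr 1
    · conv_lhs => rw [← b.sum_repr (C w (b i))]
      rw [map_sum, LinearMap.sum_apply]
      exact Finset.sum_congr rfl fun l _ ↦ by rw [map_smul, LinearMap.smul_apply]; rfl
    · conv_lhs => rw [← b.sum_repr (C w (b j))]
      rw [map_sum]
      exact Finset.sum_congr rfl fun l _ ↦ by rw [map_smul, smul_eq_mul, mul_comm]; rfl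
  have hA' : (∑ j, ∑ i, (A x).adjugate j i •
      fderiv ℝ (fun x ↦ firstForm G F x (b i) (b j)) x) w = 2 * (A x).det * c.trace := by
    have h0 := Matrix.trace_adjugate_mul_transpose_mul_add (A x) c 0
    rw [mul_zero, Matrix.trace_zero, zero_add, zero_add] at h0
    rw [← h0, Matrix.trace]
    simp only [sum_apply, smul_apply, Matrix.diag_apply, smul_eq_mul]
    refine Finset.sum_congr rfl fun j _ ↦ ?_
    rw [Matrix.mul_apply]
    refine Finset.sum_congr rfl fun i _ ↦ ?_
    refine congrArg ((A x).adjugate j i * ·) (Eq.trans (h.fderiv_firstForm hx hC w _ _) ?_)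
    exact expand (firstFormBilin G F x) i j
  have hB' : (∑ j, ∑ i, (B x).adjugate j i •
      fderiv ℝ (fun x ↦ secondForm G F E ε x (b i) (b j)) x) w =
        ((B x).adjugate * T).trace + 2 * (B x).det * c.trace := by
    rw [← Matrix.trace_adjugate_mul_transpose_mul_add (B x) c T, Matrix.trace]
    simp only [sum_apply, smul_apply, Matrix.diag_apply, smul_eq_mul]
    refine Finset.sum_congr rfl fun j _ ↦ ?_
    rw [Matrix.mul_apply]
    refine Finset.sum_congr rfl fun i _ ↦ ?_
    have h1 := expand (secondFormBilin G F E ε x) i j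
    have h2 : fderiv ℝ (fun x ↦ secondForm G F E ε x (b i) (b j)) x w = T i j +
        (secondFormBilin G F E ε x (C w (b i)) (b j) +
          secondFormBilin G F E ε x (b i) (C w (b j))) := by
      simp only [hT, Matrix.of_apply, covDerivSecondForm, secondFormBilin_apply]
      ring
    exact congrArg ((B x).adjugate j i * ·) (h2.trans (congrArg (T i j + ·) h1))
  have hS : ((B x).adjugate * T).trace = (B x).det * ∑ i, ∑ j, (B x)⁻¹ i j * T i j := by
    have hTs (i j : ι) : T i j = T j i := h.covDerivSecondForm_symm hx w (b i) (b j)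
    rw [Matrix.trace, Finset.mul_sum]
    refine Finset.sum_congr rfl fun i _ ↦ ?_
    rw [Matrix.diag_apply, Matrix.mul_apply, Finset.mul_sum]
    refine Finset.sum_congr rfl fun j _ ↦ ?_
    rw [Matrix.inv_def, Ring.inverse_eq_inv', Matrix.smul_apply, smul_eq_mul, hTs j i, ← mul_assoc,
      mul_inv_cancel_left₀ hH]
  -- Differentiate `k det I = κ det h`. Both sides acquire `2 tr c` times themselves, which cancels;
  -- only the trace of the covariant derivative of `h` remains, because that of `I` vanishes.
  have hprod : fderiv ℝ (fun x ↦ k x * (A x).det) x w = fderiv ℝ (fun x ↦ κ * (B x).det) x w := by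
    rw [EventuallyEq.fderiv_eq hk]
  rw [fderiv_fun_mul hkd hdA.differentiableAt, fderiv_const_mul hdB.differentiableAt, hdA.fderiv,
    hdB.fderiv, add_apply, smul_apply, smul_apply, smul_apply, hA', hB', hS] at hprod
  simp only [smul_eq_mul] at hprod
  have hkx := hk.self_of_nhds
  refine mul_left_cancel₀ hI ?_
  change (A x).det * _ = (A x).det * (k x * ∑ i, ∑ j, (B x)⁻¹ i j * T i j)
  change k x * (A x).det = κ * (B x).det at hkx
  linear_combination hprod - (2 * c.trace + ∑ i, ∑ j, (B x)⁻¹ i j * T i j) * hkx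

end IsNormalField

end LocalMetric

/-! ### Preferred charts and their differentials -/

section charts

open Filter Topology

variable {m : ℕ} {M : Type*} [TopologicalSpace M] [ChartedSpace (RSpace m) M]
  [IsManifold (𝓡 m) ∞ M]

/-- The differential at `x` of the preferred chart at `x₀`. -/
def chartDeriv (x₀ x : M) : TangentSpace (𝓡 m) x →L[ℝ] RSpace m :=
  mvfderiv (𝓡 m) (extChartAt (𝓡 m) x₀) x

variable {x₀ x₁ x : M} {y : RSpace m}

theorem contMDiffAt_chart (hx : x ∈ (extChartAt (𝓡 m) x₀).source) :
    ContMDiffAt (𝓡 m) 𝓘(ℝ, RSpace m) ∞ (extChartAt (𝓡 m) x₀) x :=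
  contMDiffAt_extChartAt' (by rwa [extChartAt_source] at hx)

theorem contMDiffAt_chart_symm (hy : y ∈ (extChartAt (𝓡 m) x₀).target) :
    ContMDiffAt 𝓘(ℝ, RSpace m) (𝓡 m) ∞ (extChartAt (𝓡 m) x₀).symm y :=
  (contMDiffOn_extChartAt_symm x₀).contMDiffAt (extChartAt_target_mem_nhds' hy)

theorem contDiffAt_comp_chart_symm {R : Type*} [NormedAddCommGroup R] [NormedSpace ℝ R]
    {h : M → R} (hx : x ∈ (extChartAt (𝓡 m) x₀).source)
    (hh : ContMDiffAt (𝓡 m) 𝓘(ℝ, R) ∞ h x) :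
    ContDiffAt ℝ ∞ (fun y ↦ h ((extChartAt (𝓡 m) x₀).symm y)) (extChartAt (𝓡 m) x₀ x) := by
  rw [← contMDiffAt_iff_contDiffAt]
  refine ContMDiffAt.comp (I' := 𝓡 m) _ (g := h) ?_
    (contMDiffAt_chart_symm ((extChartAt (𝓡 m) x₀).map_source hx))
  rwa [(extChartAt (𝓡 m) x₀).left_inv hx]

theorem mvfderiv_eq_fderiv_comp_chartDeriv {R : Type*} [NormedAddCommGroup R] [NormedSpace ℝ R]
    {h : M → R} (hx : x ∈ (extChartAt (𝓡 m) x₀).source)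
    (hh : DifferentiableAt ℝ (fun y ↦ h ((extChartAt (𝓡 m) x₀).symm y)) (extChartAt (𝓡 m) x₀ x)) :
    mvfderiv (𝓡 m) h x =
      fderiv ℝ (fun y ↦ h ((extChartAt (𝓡 m) x₀).symm y)) (extChartAt (𝓡 m) x₀ x) ∘L
        chartDeriv x₀ x := by
  have h1 : h =ᶠ[𝓝 x] (fun y ↦ h ((extChartAt (𝓡 m) x₀).symm y)) ∘ extChartAt (𝓡 m) x₀ := by
    filter_upwards [extChartAt_source_mem_nhds' hx] with x' hx'
    simp only [Function.comp_apply]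
    rw [(extChartAt (𝓡 m) x₀).left_inv hx']
  have h2 := mfderiv_comp x hh.mdifferentiableAt
    ((contMDiffAt_chart hx).mdifferentiableAt (by simp))
  rw [mvfderiv, h1.mfderiv_eq, h2, mfderiv_eq_fderiv]
  rfl

theorem isInvertible_chartDeriv (hx : x ∈ (extChartAt (𝓡 m) x₀).source) :
    (chartDeriv (m := m) x₀ x).IsInvertible :=
  isInvertible_mfderiv_extChartAt hx

theorem chartDeriv_injective (hx : x ∈ (extChartAt (𝓡 m) x₀).source) :
    Function.Injective (chartDeriv (m := m) x₀ x) := by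
  obtain ⟨e, he⟩ := isInvertible_chartDeriv hx
  rw [← he]
  exact e.injective

theorem chartDeriv_surjective (hx : x ∈ (extChartAt (𝓡 m) x₀).source) :
    Function.Surjective (chartDeriv (m := m) x₀ x) := by
  obtain ⟨e, he⟩ := isInvertible_chartDeriv hx
  rw [← he]
  exact e.surjective

/-- The tangent space at `x` is the model space, identified with it through the preferred chart at
`x` itself. -/
theorem chartDeriv_self (v : TangentSpace (𝓡 m) x) : chartDeriv x x v = v := by
  have h : mfderiv (𝓡 m) 𝓘(ℝ, RSpace m) (extChartAt (𝓡 m) x) x v = v := by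
    rw [mfderiv_extChartAt_self]
    rfl
  exact h

/-- The change of coordinates between two charts. -/
def chartChange (x₀ x₁ : M) (y : RSpace m) : RSpace m :=
  extChartAt (𝓡 m) x₁ ((extChartAt (𝓡 m) x₀).symm y)

theorem contDiffAt_chartChange (hx : x ∈ (extChartAt (𝓡 m) x₀).source)
    (hx' : x ∈ (extChartAt (𝓡 m) x₁).source) :
    ContDiffAt ℝ ∞ (chartChange x₀ x₁) (extChartAt (𝓡 m) x₀ x) :=
  contDiffAt_comp_chart_symm hx (contMDiffAt_chart hx')

theorem chartDeriv_eq (hx : x ∈ (extChartAt (𝓡 m) x₀).source)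
    (hx' : x ∈ (extChartAt (𝓡 m) x₁).source) :
    chartDeriv x₁ x = fderiv ℝ (chartChange x₀ x₁) (extChartAt (𝓡 m) x₀ x) ∘L chartDeriv x₀ x :=
  mvfderiv_eq_fderiv_comp_chartDeriv hx
    ((contDiffAt_chartChange hx hx').differentiableAt (by simp))

theorem chartDeriv_symm_mfderiv (hy : y ∈ (extChartAt (𝓡 m) x₀).target) (v : RSpace m) :
    chartDeriv x₀ ((extChartAt (𝓡 m) x₀).symm y)
      (mfderiv 𝓘(ℝ, RSpace m) (𝓡 m) (extChartAt (𝓡 m) x₀).symm y v) = v := by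
  have h := mfderiv_extChartAt_comp_mfderivWithin_extChartAt_symm (I := 𝓡 m) hy
  have hr : Set.range (𝓡 m) = Set.univ := by simp
  rw [hr, mfderivWithin_univ] at h
  exact congrArg (fun L ↦ L v) h

/-- A field `W` along `f : S → M` is smooth iff its components are. -/
theorem contMDiffAt_chartDeriv_apply {k : ℕ} {S : Type*} [TopologicalSpace S]
    [ChartedSpace (RSpace k) S] [IsManifold (𝓡 k) ∞ S] {f : S → M} {q : S}
    {W : (p : S) → TangentSpace (𝓡 m) (f p)} (hq : f q ∈ (extChartAt (𝓡 m) x₀).source)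
    (hW : ContMDiffAt (𝓡 k) (𝓡 m).tangent ∞
      (fun p ↦ (⟨f p, W p⟩ : TangentBundle (𝓡 m) M)) q) :
    ContMDiffAt (𝓡 k) 𝓘(ℝ, RSpace m) ∞ (fun p ↦ chartDeriv x₀ (f p) (W p)) q := by
  rw [extChartAt_source] at hq
  have h := (Bundle.Trivialization.contMDiffAt_iff (n := ∞) (IM := 𝓡 k) (IB := 𝓡 m)
    (e := trivializationAt (RSpace m) (TangentSpace (𝓡 m)) x₀)
    (f := fun p ↦ (⟨f p, W p⟩ : TangentBundle (𝓡 m) M)) (x₀ := q)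
    (by rw [TangentBundle.trivializationAt_source]; exact hq)).1 hW
  refine h.2.congr_of_eventuallyEq ?_
  filter_upwards [h.1.continuousAt.preimage_mem_nhds ((chartAt (RSpace m) x₀).open_source.mem_nhds
    hq)] with p hp
  have hp' : f p ∈ (chartAt (RSpace m) x₀).source := hp
  have h2 := TangentBundle.continuousLinearMapAt_trivializationAt (I := 𝓡 m) hp'
  have h3 : chartDeriv x₀ (f p) (W p) =
    (trivializationAt (RSpace m) (TangentSpace (𝓡 m)) x₀).continuousLinearMapAt ℝ (f p) (W p) := by
    rw [h2]
    rfl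
  rw [h3, Bundle.Trivialization.continuousLinearMapAt_apply,
    Bundle.Trivialization.coe_linearMapAt_of_mem _
      (by rw [TangentBundle.trivializationAt_baseSet]; exact hp')]

/-- `FiberBundle.extend` keeps the components constant in the trivialization at `x₀`, and this
trivialization is the differential of the chart at `x₀`. -/
theorem chartDeriv_extendVector (hx : x ∈ (extChartAt (𝓡 m) x₀).source)
    (v : TangentSpace (𝓡 m) x₀) :
    chartDeriv x₀ x (FiberBundle.extend (RSpace m) v x) = v := by
  rw [extChartAt_source] at hx
  have h2 := TangentBundle.continuousLinearMapAt_trivializationAt (I := 𝓡 m) hx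
  have h0 := TangentBundle.continuousLinearMapAt_trivializationAt (I := 𝓡 m)
    (mem_chart_source (RSpace m) x₀)
  have h3 (w : TangentSpace (𝓡 m) x) : chartDeriv x₀ x w =
      (trivializationAt (RSpace m) (TangentSpace (𝓡 m)) x₀).continuousLinearMapAt ℝ x w := by
    rw [h2]
    rfl
  obtain ⟨w, hw⟩ : ∃ w : RSpace m, w = v := ⟨v, rfl⟩
  have h4 : (trivializationAt (RSpace m) (TangentSpace (𝓡 m)) x₀ ⟨x₀, v⟩).2 = w := by
    rw [hw]
    have h5 : (trivializationAt (RSpace m) (TangentSpace (𝓡 m)) x₀).continuousLinearMapAt ℝ x₀ v =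
        v := by
      rw [h0]
      exact chartDeriv_self v
    rwa [Bundle.Trivialization.continuousLinearMapAt_apply,
      Bundle.Trivialization.coe_linearMapAt_of_mem _
        (by rw [TangentBundle.trivializationAt_baseSet]; exact mem_chart_source (RSpace m) x₀)] at h5
  rw [h3, FiberBundle.extend, h4]
  have hb : x ∈ (trivializationAt (RSpace m) (TangentSpace (𝓡 m)) x₀).baseSet := by
    rw [TangentBundle.trivializationAt_baseSet]; exact hx
  have h6 := Bundle.Trivialization.continuousLinearMapAt_symmL (R := ℝ)
    (trivializationAt (RSpace m) (TangentSpace (𝓡 m)) x₀) hb w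
  rw [Bundle.Trivialization.symmL_apply _ hb] at h6
  exact h6.trans hw

end charts

/-! ### The components of the metric in a chart -/

namespace PseudoRiemannianMetric

open Filter Topology

variable {m : ℕ} {M : Type*} [TopologicalSpace M] [ChartedSpace (RSpace m) M]
  [IsManifold (𝓡 m) ∞ M] (g : PseudoRiemannianMetric m M) {x₀ x : M} {y : RSpace m}

theorem inChart_apply (x₀ : M) (y v w : RSpace m) :
    g.inChart x₀ y v w = g.val ((extChartAt (𝓡 m) x₀).symm y)
      (mfderiv 𝓘(ℝ, RSpace m) (𝓡 m) (extChartAt (𝓡 m) x₀).symm y v)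
      (mfderiv 𝓘(ℝ, RSpace m) (𝓡 m) (extChartAt (𝓡 m) x₀).symm y w) := rfl

theorem inChart_chartDeriv (hx : x ∈ (extChartAt (𝓡 m) x₀).source) (v w : TangentSpace (𝓡 m) x) :
    g.inChart x₀ (extChartAt (𝓡 m) x₀ x) (chartDeriv x₀ x v) (chartDeriv x₀ x w) =
      g.val x v w := by
  obtain ⟨y, hy, rfl⟩ : ∃ y ∈ (extChartAt (𝓡 m) x₀).target, (extChartAt (𝓡 m) x₀).symm y = x :=
    ⟨_, (extChartAt (𝓡 m) x₀).map_source hx, (extChartAt (𝓡 m) x₀).left_inv hx⟩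
  have h (v : TangentSpace (𝓡 m) ((extChartAt (𝓡 m) x₀).symm y)) :
      mfderiv 𝓘(ℝ, RSpace m) (𝓡 m) (extChartAt (𝓡 m) x₀).symm y (chartDeriv x₀ _ v) = v :=
    chartDeriv_injective hx (chartDeriv_symm_mfderiv hy _)
  rw [(extChartAt (𝓡 m) x₀).right_inv hy, inChart_apply, h, h]

theorem inChart_symm (y v w : RSpace m) : g.inChart x₀ y v w = g.inChart x₀ y w v := by
  rw [inChart_apply, inChart_apply, g.symm]

theorem isInvertible_inChart (hy : y ∈ (extChartAt (𝓡 m) x₀).target) :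
    (g.inChart x₀ y).IsInvertible := by
  refine LocalMetric.isInvertible_of_nondegenerate fun v hv ↦ ?_
  have h := g.nondegenerate _
    (mfderiv 𝓘(ℝ, RSpace m) (𝓡 m) (extChartAt (𝓡 m) x₀).symm y v) fun w ↦ by
      have hs : w = mfderiv 𝓘(ℝ, RSpace m) (𝓡 m) (extChartAt (𝓡 m) x₀).symm y
          (chartDeriv x₀ _ w) :=
        (chartDeriv_injective ((extChartAt (𝓡 m) x₀).map_target hy)
          (chartDeriv_symm_mfderiv hy _)).symm
      rw [hs, ← inChart_apply, hv]
  rw [← chartDeriv_symm_mfderiv hy v, h, map_zero]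

theorem contMDiffAt_val_apply {k : ℕ} {S : Type*} [TopologicalSpace S]
    [ChartedSpace (RSpace k) S] {f : S → M} {q : S} {V W : (p : S) → TangentSpace (𝓡 m) (f p)}
    (hV : ContMDiffAt (𝓡 k) (𝓡 m).tangent ∞ (fun p ↦ (⟨f p, V p⟩ : TangentBundle (𝓡 m) M)) q)
    (hW : ContMDiffAt (𝓡 k) (𝓡 m).tangent ∞ (fun p ↦ (⟨f p, W p⟩ : TangentBundle (𝓡 m) M)) q) :
    ContMDiffAt (𝓡 k) 𝓘(ℝ) ∞ (fun p ↦ g.val (f p) (V p) (W p)) q := by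
  have hf : ContMDiffAt (𝓡 k) (𝓡 m) ∞ f q := (Bundle.contMDiffAt_totalSpace.1 hV).1
  have h : ContMDiffAt (𝓡 k) ((𝓡 m).prod 𝓘(ℝ)) ∞ (fun p ↦ Bundle.TotalSpace.mk' ℝ
      (E := Bundle.Trivial M ℝ) (f p) (g.val (f p) (V p) (W p))) q := by
    apply ContMDiffAt.clm_bundle_apply₂ (F₁ := RSpace m) (F₂ := RSpace m)
    · exact ContMDiffAt.comp q g.contMDiff.contMDiffAt hf
    · exact hV
    · exact hW
  exact (Bundle.contMDiffAt_totalSpace.1 h).2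

/-- It suffices to treat each component `G_y(v, w)`. It is the value of `g` on the fields extending
`v` and `w`, which are smooth and have constant components in the chart. -/
theorem contDiffAt_inChart (hy : y ∈ (extChartAt (𝓡 m) x₀).target) :
    ContDiffAt ℝ ∞ (g.inChart x₀) y := by
  suffices h : ContDiffOn ℝ ∞ (g.inChart x₀) (extChartAt (𝓡 m) x₀).target from
    h.contDiffAt (extChartAt_target_mem_nhds' hy)
  suffices h : ∀ v w : TangentSpace (𝓡 m) x₀,
      ContDiffOn ℝ ∞ (fun y ↦ g.inChart x₀ y v w) (extChartAt (𝓡 m) x₀).target from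
    contDiffOn_clm_apply.2 fun v ↦ contDiffOn_clm_apply.2 fun w ↦ h v w
  intro v w y hy
  refine ContDiffAt.contDiffWithinAt ?_
  have hx := (extChartAt (𝓡 m) x₀).map_target hy
  have hsec (v : TangentSpace (𝓡 m) x₀) : ContMDiffAt (𝓡 m) (𝓡 m).tangent ∞
      (fun x ↦ (⟨x, FiberBundle.extend (RSpace m) v x⟩ :
        TangentBundle (𝓡 m) M)) ((extChartAt (𝓡 m) x₀).symm y) := by
    have hb : (extChartAt (𝓡 m) x₀).symm y ∈
        (trivializationAt (RSpace m) (TangentSpace (𝓡 m)) x₀).baseSet := by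
      rwa [extChartAt_source] at hx
    refine (Bundle.Trivialization.contMDiffAt_section_iff
      (trivializationAt (RSpace m) (TangentSpace (𝓡 m)) x₀) hb).2 ?_
    refine (contMDiffAt_const
      (c := (trivializationAt (RSpace m) (TangentSpace (𝓡 m)) x₀ ⟨x₀, v⟩).2)).congr_of_eventuallyEq ?_
    filter_upwards [(trivializationAt (RSpace m) (TangentSpace (𝓡 m)) x₀).open_baseSet.mem_nhds hb]
      with x hx
    rw [FiberBundle.extend, Bundle.Trivialization.apply_mk_symm _ hx]
  have h1 := contDiffAt_comp_chart_symm hx (g.contMDiffAt_val_apply (hsec v) (hsec w))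
  rw [(extChartAt (𝓡 m) x₀).right_inv hy] at h1
  refine h1.congr_of_eventuallyEq ?_
  filter_upwards [extChartAt_target_mem_nhds' hy] with y' hy'
  have hx' := (extChartAt (𝓡 m) x₀).map_target hy'
  rw [← g.inChart_chartDeriv hx', chartDeriv_extendVector hx', chartDeriv_extendVector hx',
    (extChartAt (𝓡 m) x₀).right_inv hy']

end PseudoRiemannianMetric

namespace PseudoRiemannianMetric

open Filter Topology

variable {m : ℕ} {M : Type*} [TopologicalSpace M] [ChartedSpace (RSpace m) M]
  [IsManifold (𝓡 m) ∞ M] (g : PseudoRiemannianMetric m M) {x₀ x₁ x : M}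

theorem inChart_eq_chartChange (hx : x ∈ (extChartAt (𝓡 m) x₀).source)
    (hx' : x ∈ (extChartAt (𝓡 m) x₁).source) (v w : RSpace m) :
    g.inChart x₀ (extChartAt (𝓡 m) x₀ x) v w =
      g.inChart x₁ (chartChange x₀ x₁ (extChartAt (𝓡 m) x₀ x))
        (fderiv ℝ (chartChange x₀ x₁) (extChartAt (𝓡 m) x₀ x) v)
        (fderiv ℝ (chartChange x₀ x₁) (extChartAt (𝓡 m) x₀ x) w) := by
  obtain ⟨v, rfl⟩ := chartDeriv_surjective hx v
  obtain ⟨w, rfl⟩ := chartDeriv_surjective hx w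
  have h (v : TangentSpace (𝓡 m) x) : fderiv ℝ (chartChange x₀ x₁) (extChartAt (𝓡 m) x₀ x)
      (chartDeriv x₀ x v) = chartDeriv x₁ x v := by
    rw [chartDeriv_eq hx hx']
    rfl
  have hc : chartChange x₀ x₁ (extChartAt (𝓡 m) x₀ x) = extChartAt (𝓡 m) x₁ x := by
    rw [chartChange, (extChartAt (𝓡 m) x₀).left_inv hx]
  rw [g.inChart_chartDeriv hx, h, h, hc, g.inChart_chartDeriv hx']

end PseudoRiemannianMetric

/-! ### Immersions in charts; invariance of the covariant derivative -/

namespace Hypersurface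

open Filter Topology

variable {n : ℕ} {M : Type*} [TopologicalSpace M] [ChartedSpace (RSpace (n + 1)) M]
  [IsManifold (𝓡 (n + 1)) ∞ M]
  {S : Type*} [TopologicalSpace S] [ChartedSpace (RSpace n) S] [IsManifold (𝓡 n) ∞ S]
  {f : S → M} {p q : S}

/-- The map `f` in the preferred charts at `p` and `f p`. -/
def localMap (f : S → M) (p : S) (x : RSpace n) : RSpace (n + 1) :=
  extChartAt (𝓡 (n + 1)) (f p) (f ((extChartAt (𝓡 n) p).symm x))

/-- A field along `f` in the preferred charts at `p` and `f p`. -/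
def localField (f : S → M) (p : S) (W : (p : S) → TangentSpace (𝓡 (n + 1)) (f p)) (x : RSpace n) :
    RSpace (n + 1) :=
  chartDeriv (f p) (f ((extChartAt (𝓡 n) p).symm x)) (W ((extChartAt (𝓡 n) p).symm x))

theorem contDiffAt_localMap (hf : ContMDiff (𝓡 n) (𝓡 (n + 1)) ∞ f)
    (hq : q ∈ (extChartAt (𝓡 n) p).source) (hfq : f q ∈ (extChartAt (𝓡 (n + 1)) (f p)).source) :
    ContDiffAt ℝ ∞ (localMap f p) (extChartAt (𝓡 n) p q) :=
  contDiffAt_comp_chart_symm (h := fun q ↦ extChartAt (𝓡 (n + 1)) (f p) (f q)) hq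
    ((contMDiffAt_chart hfq).comp q hf.contMDiffAt)

theorem contDiffAt_localField {W : (p : S) → TangentSpace (𝓡 (n + 1)) (f p)}
    (hq : q ∈ (extChartAt (𝓡 n) p).source) (hfq : f q ∈ (extChartAt (𝓡 (n + 1)) (f p)).source)
    (hW : ContMDiffAt (𝓡 n) (𝓡 (n + 1)).tangent ∞
      (fun p ↦ (⟨f p, W p⟩ : TangentBundle (𝓡 (n + 1)) M)) q) :
    ContDiffAt ℝ ∞ (localField f p W) (extChartAt (𝓡 n) p q) :=
  contDiffAt_comp_chart_symm (h := fun q ↦ chartDeriv (f p) (f q) (W q)) hq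
    (contMDiffAt_chartDeriv_apply hfq hW)

theorem fderiv_comp_chart_symm_chartDeriv (hf : ContMDiff (𝓡 n) (𝓡 (n + 1)) ∞ f) {x₀ : M}
    (hq : q ∈ (extChartAt (𝓡 n) p).source) (hfq : f q ∈ (extChartAt (𝓡 (n + 1)) x₀).source)
    (u : TangentSpace (𝓡 n) q) :
    fderiv ℝ (fun x ↦ extChartAt (𝓡 (n + 1)) x₀ (f ((extChartAt (𝓡 n) p).symm x)))
      (extChartAt (𝓡 n) p q) (chartDeriv p q u) =
      chartDeriv x₀ (f q) (mfderiv (𝓡 n) (𝓡 (n + 1)) f q u) := by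
  have h1 := mvfderiv_eq_fderiv_comp_chartDeriv (h := fun q ↦ extChartAt (𝓡 (n + 1)) x₀ (f q)) hq
    ((contDiffAt_comp_chart_symm hq
      ((contMDiffAt_chart hfq).comp q hf.contMDiffAt)).differentiableAt (by simp))
  have h2 := mfderiv_comp q ((contMDiffAt_chart hfq).mdifferentiableAt (by simp))
    (hf.contMDiffAt.mdifferentiableAt (by simp))
  refine Eq.trans (congrArg (fun L ↦ L u) h1).symm ?_
  exact congrArg (fun L ↦ L u) h2

theorem fderiv_localMap_chartDeriv (hf : ContMDiff (𝓡 n) (𝓡 (n + 1)) ∞ f)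
    (hq : q ∈ (extChartAt (𝓡 n) p).source) (hfq : f q ∈ (extChartAt (𝓡 (n + 1)) (f p)).source)
    (u : TangentSpace (𝓡 n) q) :
    fderiv ℝ (localMap f p) (extChartAt (𝓡 n) p q) (chartDeriv p q u) =
      chartDeriv (f p) (f q) (mfderiv (𝓡 n) (𝓡 (n + 1)) f q u) :=
  fderiv_comp_chart_symm_chartDeriv hf hq hfq u

/-- The covariant derivative along `f` can be computed in any of the preferred charts. -/
theorem chartDeriv_covDerivAlong (g : PseudoRiemannianMetric (n + 1) M)
    (hf : ContMDiff (𝓡 n) (𝓡 (n + 1)) ∞ f)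
    (hq : q ∈ (extChartAt (𝓡 n) p).source) (hfq : f q ∈ (extChartAt (𝓡 (n + 1)) (f p)).source)
    {W : (p : S) → TangentSpace (𝓡 (n + 1)) (f p)}
    (hW : ContMDiffAt (𝓡 n) (𝓡 (n + 1)).tangent ∞
      (fun p ↦ (⟨f p, W p⟩ : TangentBundle (𝓡 (n + 1)) M)) q)
    (u : TangentSpace (𝓡 n) q) :
    chartDeriv (f p) (f q) (covDerivAlong g f W q u) =
      LocalMetric.covDeriv (g.inChart (f p)) (localMap f p) (localField f p W)
        (extChartAt (𝓡 n) p q) (chartDeriv p q u) := by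
  set κ := extChartAt (𝓡 n) p
  set x := κ q with hx
  have hqx : κ.symm x = q := κ.left_inv hq
  have hqq := mem_extChartAt_source (I := 𝓡 (n + 1)) (f q)
  set F' : RSpace n → RSpace (n + 1) := fun x ↦ extChartAt (𝓡 (n + 1)) (f q) (f (κ.symm x)) with hF'
  set Y' : RSpace n → RSpace (n + 1) :=
    fun x ↦ chartDeriv (f q) (f (κ.symm x)) (W (κ.symm x)) with hY'
  have hF'x : F' x = extChartAt (𝓡 (n + 1)) (f q) (f q) := by rw [hF']; simp only [hqx]
  have hY'x : Y' x = chartDeriv (f q) (f q) (W q) :=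
    congrArg (fun q' ↦ chartDeriv (f q) (f q') (W q')) hqx
  have hF'd : DifferentiableAt ℝ F' x :=
    (contDiffAt_comp_chart_symm (h := fun p ↦ extChartAt (𝓡 (n + 1)) (f q) (f p)) hq
      ((contMDiffAt_chart hqq).comp q hf.contMDiffAt)).differentiableAt (by simp)
  have hY'd : DifferentiableAt ℝ Y' x :=
    (contDiffAt_comp_chart_symm (h := fun p ↦ chartDeriv (f q) (f p) (W p)) hq
      (contMDiffAt_chartDeriv_apply hqq hW)).differentiableAt (by simp)
  -- The definition at `q` uses the chart of `M` at `f q`. Here only the parameter domain is moved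
  -- to the chart of `S` at `p`; the target chart is changed afterwards, with the transition map as
  -- `ψ`.
  have hlocal : chartDeriv (f q) (f q) (covDerivAlong g f W q u) =
      LocalMetric.covDeriv (g.inChart (f q)) F' Y' x (chartDeriv p q u) := by
    have h1 : covDerivAlong g f W q = (chartDeriv (f q) (f q)).inverse ∘L
        (mvfderiv (𝓡 n) (fun p ↦ chartDeriv (f q) (f p) (W p)) q +
          (g.christoffel (f q) (extChartAt (𝓡 (n + 1)) (f q) (f q))).flip
            (chartDeriv (f q) (f q) (W q)) ∘L
            (chartDeriv (f q) (f q) ∘L mfderiv (𝓡 n) (𝓡 (n + 1)) f q)) := rfl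
    have h2 := mvfderiv_eq_fderiv_comp_chartDeriv
      (h := fun p ↦ chartDeriv (f q) (f p) (W p)) hq hY'd
    have h3 : fderiv ℝ F' x (chartDeriv p q u) = _ :=
      fderiv_comp_chart_symm_chartDeriv hf hq hqq u
    have hinv (v : RSpace (n + 1)) :
        chartDeriv (f q) (f q) ((chartDeriv (f q) (f q)).inverse v) = v := by
      obtain ⟨e, he⟩ := isInvertible_chartDeriv hqq
      rw [← he, ContinuousLinearMap.inverse_equiv]
      exact e.apply_symm_apply v
    rw [LocalMetric.covDeriv_apply, h1, h2, hF'x, hY'x, h3]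
    exact hinv _
  have hcont : ContinuousAt (fun x ↦ f (κ.symm x)) x := by
    refine ContinuousAt.comp (g := f) hf.continuous.continuousAt ?_
    exact (contMDiffAt_chart_symm (κ.map_source hq)).continuousAt
  have hev : ∀ᶠ x' in 𝓝 x, f (κ.symm x') ∈ (extChartAt (𝓡 (n + 1)) (f q)).source ∧
      f (κ.symm x') ∈ (extChartAt (𝓡 (n + 1)) (f p)).source := by
    have h : (extChartAt (𝓡 (n + 1)) (f q)).source ∩ (extChartAt (𝓡 (n + 1)) (f p)).source ∈
        𝓝 (f (κ.symm x)) :=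
      (((isOpen_extChartAt_source (f q)).inter (isOpen_extChartAt_source (f p))).mem_nhds
        (by rw [hqx]; exact ⟨hqq, hfq⟩))
    exact hcont.preimage_mem_nhds h
  have hψ := contDiffAt_chartChange hqq hfq
  have hψx : chartChange (f q) (f p) (extChartAt (𝓡 (n + 1)) (f q) (f q)) =
      extChartAt (𝓡 (n + 1)) (f p) (f q) := by
    rw [chartChange, (extChartAt (𝓡 (n + 1)) (f q)).left_inv hqq]
  have hcomp (v : TangentSpace (𝓡 (n + 1)) (f q)) : chartDeriv (f p) (f q) v =
      fderiv ℝ (chartChange (f q) (f p)) (F' x) (chartDeriv (f q) (f q) v) := by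
    rw [chartDeriv_eq hqq hfq, hF'x]
    rfl
  rw [hcomp, hlocal]
  refine (LocalMetric.covDeriv_pullback ?_ ?_ (.of_forall fun y v w ↦ g.inChart_symm y v w) ?_ ?_
    ?_ ?_ ?_ hF'd hY'd ?_ ?_ _).symm
  · rw [hF'x]
    exact hψ.of_le (by norm_cast)
  · rw [hF'x, hψx]
    exact (g.contDiffAt_inChart (PartialEquiv.map_source _ hfq)).differentiableAt (by simp)
  · rw [hF'x]
    have h1 : (extChartAt (𝓡 (n + 1)) (f q)).target ∈ 𝓝 (extChartAt (𝓡 (n + 1)) (f q) (f q)) :=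
      extChartAt_target_mem_nhds (f q)
    have h2 : ∀ᶠ y in 𝓝 (extChartAt (𝓡 (n + 1)) (f q) (f q)),
        (extChartAt (𝓡 (n + 1)) (f q)).symm y ∈ (extChartAt (𝓡 (n + 1)) (f p)).source :=
      (continuousAt_extChartAt_symm (f q)).preimage_mem_nhds
        ((isOpen_extChartAt_source (f p)).mem_nhds (by rwa [PartialEquiv.left_inv _ hqq]))
    filter_upwards [h1, h2] with y hy hy' v w
    have h3 := g.inChart_eq_chartChange ((extChartAt (𝓡 (n + 1)) (f q)).map_target hy) hy' v w
    rwa [(extChartAt (𝓡 (n + 1)) (f q)).right_inv hy] at h3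
  · rw [hF'x]
    exact (g.contDiffAt_inChart (PartialEquiv.map_source _ hqq)).differentiableAt (by simp)
  · rw [hF'x, hψx]
    exact g.isInvertible_inChart (PartialEquiv.map_source _ hfq)
  · rw [hF'x]
    exact g.isInvertible_inChart (PartialEquiv.map_source _ hqq)
  · intro w
    obtain ⟨v, rfl⟩ := chartDeriv_surjective hfq w
    exact ⟨_, (hcomp v).symm⟩
  · filter_upwards [hev] with x' hx'
    rw [localMap, chartChange, hF', (extChartAt (𝓡 (n + 1)) (f q)).left_inv hx'.1]
  · filter_upwards [hev] with x' hx'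
    rw [localField, chartDeriv_eq hx'.1 hx'.2]
    rfl

end Hypersurface

/-! ### Transverse fields and the normal field in charts -/

namespace Hypersurface

open Filter Topology

variable {n : ℕ} {M : Type*} [TopologicalSpace M] [ChartedSpace (RSpace (n + 1)) M]
  [IsManifold (𝓡 (n + 1)) ∞ M]
  {S : Type*} [TopologicalSpace S] [ChartedSpace (RSpace n) S] [IsManifold (𝓡 n) ∞ S]
  {f : S → M} {p q : S} {N E ν : (p : S) → TangentSpace (𝓡 (n + 1)) (f p)}

/-! ### The splitting determined by a transverse field -/

theorem splitting_apply (v : TangentSpace (𝓡 n) p) (c : ℝ) :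
    splitting f N p (v, c) = mfderiv (𝓡 n) (𝓡 (n + 1)) f p v + c • N p := rfl

theorem isInvertible_splitting (hf : Function.Injective (mfderiv (𝓡 n) (𝓡 (n + 1)) f p))
    (hN : N p ∉ Set.range (mfderiv (𝓡 n) (𝓡 (n + 1)) f p)) : (splitting f N p).IsInvertible := by
  have hinj : Function.Injective (splitting f N p).toLinearMap := by
    rw [← LinearMap.ker_eq_bot, LinearMap.ker_eq_bot']
    rintro ⟨v, c⟩ h
    have h' : mfderiv (𝓡 n) (𝓡 (n + 1)) f p v + c • N p = 0 := h
    have hc : c = 0 := by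
      by_contra hc
      refine hN ⟨-(c⁻¹ • v), ?_⟩
      rw [map_neg, map_smul, eq_neg_of_add_eq_zero_left h', smul_neg, neg_neg, smul_smul,
        inv_mul_cancel₀ hc, one_smul]
    rw [hc, zero_smul, add_zero] at h'
    have hv : v = 0 := hf (h'.trans (map_zero _).symm)
    rw [hv, hc]
    rfl
  have : FiniteDimensional ℝ (TangentSpace (𝓡 n) p) :=
    inferInstanceAs (FiniteDimensional ℝ (RSpace n))
  have : FiniteDimensional ℝ (TangentSpace (𝓡 (n + 1)) (f p)) :=
    inferInstanceAs (FiniteDimensional ℝ (RSpace (n + 1)))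
  have : T2Space (TangentSpace (𝓡 n) p) := inferInstanceAs (T2Space (RSpace n))
  have : T2Space (TangentSpace (𝓡 (n + 1)) (f p)) := inferInstanceAs (T2Space (RSpace (n + 1)))
  have h1 : Module.finrank ℝ (TangentSpace (𝓡 n) p) = n := finrank_euclideanSpace_fin
  have h2 : Module.finrank ℝ (TangentSpace (𝓡 (n + 1)) (f p)) = n + 1 :=
    finrank_euclideanSpace_fin
  have hdim : Module.finrank ℝ (TangentSpace (𝓡 n) p × ℝ) =
      Module.finrank ℝ (TangentSpace (𝓡 (n + 1)) (f p)) := by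
    rw [Module.finrank_prod, h1, h2, Module.finrank_self]
  exact ⟨(LinearEquiv.ofInjectiveOfFinrankEq
    (splitting f N p).toLinearMap hinj hdim).toContinuousLinearEquiv, by ext <;> rfl⟩

theorem inverse_splitting_apply (hf : Function.Injective (mfderiv (𝓡 n) (𝓡 (n + 1)) f p))
    (hN : N p ∉ Set.range (mfderiv (𝓡 n) (𝓡 (n + 1)) f p)) (v : TangentSpace (𝓡 n) p) (c : ℝ) :
    (splitting f N p).inverse (mfderiv (𝓡 n) (𝓡 (n + 1)) f p v + c • N p) = (v, c) := by
  rw [← splitting_apply]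
  obtain ⟨e, he⟩ := isInvertible_splitting hf hN
  rw [← he, ContinuousLinearMap.inverse_equiv]
  exact e.symm_apply_apply _

theorem tangentialPart_apply (hf : Function.Injective (mfderiv (𝓡 n) (𝓡 (n + 1)) f p))
    (hN : N p ∉ Set.range (mfderiv (𝓡 n) (𝓡 (n + 1)) f p)) (v : TangentSpace (𝓡 n) p) (c : ℝ) :
    tangentialPart f N p (mfderiv (𝓡 n) (𝓡 (n + 1)) f p v + c • N p) = v :=
  congrArg Prod.fst (inverse_splitting_apply hf hN v c)

theorem transversePart_apply (hf : Function.Injective (mfderiv (𝓡 n) (𝓡 (n + 1)) f p))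
    (hN : N p ∉ Set.range (mfderiv (𝓡 n) (𝓡 (n + 1)) f p)) (v : TangentSpace (𝓡 n) p) (c : ℝ) :
    transversePart f N p (mfderiv (𝓡 n) (𝓡 (n + 1)) f p v + c • N p) = c :=
  congrArg Prod.snd (inverse_splitting_apply hf hN v c)

theorem tangentialPart_add_transversePart
    (hf : Function.Injective (mfderiv (𝓡 n) (𝓡 (n + 1)) f p))
    (hN : N p ∉ Set.range (mfderiv (𝓡 n) (𝓡 (n + 1)) f p))
    (ξ : TangentSpace (𝓡 (n + 1)) (f p)) :
    mfderiv (𝓡 n) (𝓡 (n + 1)) f p (tangentialPart f N p ξ) + transversePart f N p ξ • N p = ξ := by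
  obtain ⟨⟨v, c⟩, rfl⟩ : ∃ w, splitting f N p w = ξ := by
    obtain ⟨e, he⟩ := isInvertible_splitting hf hN
    rw [← he]
    exact e.surjective ξ
  rw [splitting_apply, tangentialPart_apply hf hN, transversePart_apply hf hN]

theorem IsCooriented.notMem_range (h : IsCooriented f ν N) (hν : IsCoorientation f ν) (p : S) :
    N p ∉ Set.range (mfderiv (𝓡 n) (𝓡 (n + 1)) f p) := by
  rintro ⟨v, hv⟩
  obtain ⟨a, ha, w, hw⟩ := h p
  refine hν.2 p ⟨a⁻¹ • (v - w), ?_⟩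
  rw [map_smul, map_sub, hv, hw, sub_sub_cancel, smul_smul, inv_mul_cancel₀ ha.ne', one_smul]

/-- Both fields are positive multiples of `ν` modulo tangent vectors, so `ν` can be eliminated.
Positivity of the coefficient later singles out a root of `a^(n + 2) = |K|`. -/
theorem IsCooriented.exists_eq_smul_add (hN : IsCooriented f ν N) (hE : IsCooriented f ν E)
    (p : S) : ∃ a : ℝ, 0 < a ∧ ∃ z, N p = a • E p + mfderiv (𝓡 n) (𝓡 (n + 1)) f p z := by
  obtain ⟨a, ha, v, hv⟩ := hN p
  obtain ⟨b, hb, w, hw⟩ := hE p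
  refine ⟨a / b, div_pos ha hb, v - (a / b) • w, ?_⟩
  rw [map_sub, map_smul, hv, hw, smul_sub, smul_smul, div_mul_cancel₀ _ hb.ne']
  abel

/-! ### Smooth extensions of tangent vectors -/

theorem contMDiffAt_extendVector (v : TangentSpace (𝓡 n) q) :
    ContMDiffAt (𝓡 n) (𝓡 n).tangent ∞
      (fun p ↦ (⟨p, extendVector v p⟩ : TangentBundle (𝓡 n) S)) q :=
  FiberBundle.contMDiffAt_extend (𝓡 n) (RSpace n) v

theorem contMDiffAt_pushforward_extendVector (hf : ContMDiff (𝓡 n) (𝓡 (n + 1)) ∞ f)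
    (v : TangentSpace (𝓡 n) q) :
    ContMDiffAt (𝓡 n) (𝓡 (n + 1)).tangent ∞
      (fun p ↦ (⟨f p, pushforward f (extendVector v) p⟩ : TangentBundle (𝓡 (n + 1)) M)) q :=
  (ContMDiff.contMDiff_tangentMap (m := ∞) hf (by simp)).contMDiffAt.comp q
    (contMDiffAt_extendVector v)

theorem extendVector_self (v : TangentSpace (𝓡 n) p) : extendVector v p = v :=
  FiberBundle.extend_apply_self (RSpace n) v

/-- The domain, in the chart at `p`, on which `f` takes its values in the chart at `f p`. -/
def chartDomain (f : S → M) (p : S) : Set (RSpace n) :=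
  {x | x ∈ (extChartAt (𝓡 n) p).target ∧
    f ((extChartAt (𝓡 n) p).symm x) ∈ (extChartAt (𝓡 (n + 1)) (f p)).source}

theorem isOpen_chartDomain (hf : Continuous f) (p : S) : IsOpen (chartDomain (n := n) f p) := by
  have h := ContinuousOn.isOpen_inter_preimage (hf.comp_continuousOn (continuousOn_extChartAt_symm
    (I := 𝓡 n) p)) (isOpen_extChartAt_target p) (isOpen_extChartAt_source (I := 𝓡 (n + 1)) (f p))
  exact h

theorem self_mem_chartDomain (f : S → M) (p : S) :
    extChartAt (𝓡 n) p p ∈ chartDomain (n := n) f p := by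
  refine ⟨mem_extChartAt_target p, ?_⟩
  rw [extChartAt_to_inv]
  exact mem_extChartAt_source (f p)

theorem mem_chartDomain_iff (hq : q ∈ (extChartAt (𝓡 n) p).source) :
    extChartAt (𝓡 n) p q ∈ chartDomain (n := n) f p ↔
      f q ∈ (extChartAt (𝓡 (n + 1)) (f p)).source := by
  refine ⟨fun h ↦ ?_, fun h ↦ ⟨PartialEquiv.map_source _ hq, ?_⟩⟩
  · have h2 := h.2
    rwa [PartialEquiv.left_inv _ hq] at h2
  · rwa [PartialEquiv.left_inv _ hq]

/-- The second covariant derivative of `f` in charts. -/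
theorem chartDeriv_covDerivAlong_pushforward (g : PseudoRiemannianMetric (n + 1) M)
    (hf : ContMDiff (𝓡 n) (𝓡 (n + 1)) ∞ f)
    (hq : q ∈ (extChartAt (𝓡 n) p).source) (hfq : f q ∈ (extChartAt (𝓡 (n + 1)) (f p)).source)
    (u v : TangentSpace (𝓡 n) q) :
    chartDeriv (f p) (f q) (covDerivAlong g f (pushforward f (extendVector v)) q u) =
      LocalMetric.covHessian (g.inChart (f p)) (localMap f p)
        (extChartAt (𝓡 n) p q) (chartDeriv p q u) (chartDeriv p q v) +
      fderiv ℝ (localMap f p) (extChartAt (𝓡 n) p q)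
        (fderiv ℝ (fun x ↦ chartDeriv p _ (extendVector v ((extChartAt (𝓡 n) p).symm x)))
          (extChartAt (𝓡 n) p q) (chartDeriv p q u)) := by
  rw [chartDeriv_covDerivAlong g hf hq hfq (contMDiffAt_pushforward_extendVector hf v)]
  have hF := contDiffAt_localMap hf hq hfq
  have hFd : DifferentiableAt ℝ (fderiv ℝ (localMap f p)) (extChartAt (𝓡 n) p q) :=
    (hF.fderiv_right (m := 1) (by norm_cast)).differentiableAt (by simp)
  have hX : DifferentiableAt ℝ
      (fun x ↦ chartDeriv p _ (extendVector v ((extChartAt (𝓡 n) p).symm x)))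
      (extChartAt (𝓡 n) p q) :=
    (contDiffAt_comp_chart_symm (h := fun q' ↦ chartDeriv p q' (extendVector v q')) hq
      (contMDiffAt_chartDeriv_apply (f := fun q : S ↦ q) hq
        (contMDiffAt_extendVector v))).differentiableAt (by simp)
  -- The extension of `v` has constant components in the chart at `q`, not in the one at `p`. Their
  -- derivative accounts for the last term, which is tangential.
  have hloc : localField f p (pushforward f (extendVector v)) =ᶠ[𝓝 (extChartAt (𝓡 n) p q)]
      fun x ↦ fderiv ℝ (localMap f p) x
        (chartDeriv p _ (extendVector v ((extChartAt (𝓡 n) p).symm x))) := by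
    filter_upwards [(isOpen_chartDomain hf.continuous p).mem_nhds
      ((mem_chartDomain_iff hq).2 hfq)] with x hx
    have h := fderiv_localMap_chartDeriv hf (PartialEquiv.map_target _ hx.1) hx.2
      (extendVector v ((extChartAt (𝓡 n) p).symm x))
    rw [PartialEquiv.right_inv _ hx.1] at h
    rw [h]
    rfl
  rw [LocalMetric.covDeriv_congr hloc, LocalMetric.covDeriv_fderiv_apply hFd hX]
  have hv : chartDeriv p _ (extendVector v ((extChartAt (𝓡 n) p).symm (extChartAt (𝓡 n) p q))) =
      chartDeriv p q v := by
    have h : chartDeriv p q (extendVector v q) = chartDeriv p q v := by rw [extendVector_self]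
    rw [← h]
    exact congrArg (fun q' ↦ chartDeriv p q' (extendVector v q')) (PartialEquiv.left_inv _ hq)
  rw [hv]

theorem chartDeriv_covDerivAlong_pushforward_self (g : PseudoRiemannianMetric (n + 1) M)
    (hf : ContMDiff (𝓡 n) (𝓡 (n + 1)) ∞ f) (u v : TangentSpace (𝓡 n) p) :
    chartDeriv (f p) (f p) (covDerivAlong g f (pushforward f (extendVector v)) p u) =
      LocalMetric.covHessian (g.inChart (f p)) (localMap f p) (extChartAt (𝓡 n) p p)
        (chartDeriv p p u) (chartDeriv p p v) := by
  rw [chartDeriv_covDerivAlong_pushforward g hf (mem_extChartAt_source p)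
    (mem_extChartAt_source (f p))]
  obtain ⟨w, hw⟩ : ∃ w : RSpace n, w = v := ⟨v, rfl⟩
  -- At the base point the two charts agree, so the components are constant and the tangential term
  -- disappears.
  have h : (fun x ↦ chartDeriv p _ (extendVector v ((extChartAt (𝓡 n) p).symm x)))
      =ᶠ[𝓝 (extChartAt (𝓡 n) p p)] fun _ ↦ w := by
    filter_upwards [extChartAt_target_mem_nhds (I := 𝓡 n) p] with x hx
    rw [hw]
    exact chartDeriv_extendVector (PartialEquiv.map_target _ hx) v
  rw [h.fderiv_eq, fderiv_fun_const, Pi.zero_apply, zero_apply, map_zero, add_zero]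

/-! ### The unimodular normal -/

section normal

variable {g : PseudoRiemannianMetric (n + 1) M}

/-- The condition `|g(E, E)| = 1` fixes the norm up to sign only. By continuity the sign is locally
constant, and `U` is shrunk until it does not change. -/
theorem IsUnimodularNormal.exists_isNormalField (hE : IsUnimodularNormal g f ν E)
    (hf : ContMDiff (𝓡 n) (𝓡 (n + 1)) ∞ f) (p : S) :
    ∃ U ⊆ chartDomain (n := n) f p, extChartAt (𝓡 n) p p ∈ U ∧
      LocalMetric.IsNormalField (g.inChart (f p)) (localMap f p) (localField f p E)
        (g.val (f p) (E p) (E p)) U := by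
  set ε := g.val (f p) (E p) (E p) with hε
  have hnorm {q : S} (hfq : f q ∈ (extChartAt (𝓡 (n + 1)) (f p)).source)
      (hq : q ∈ (extChartAt (𝓡 n) p).source) :
      g.inChart (f p) (localMap f p (extChartAt (𝓡 n) p q))
        (localField f p E (extChartAt (𝓡 n) p q)) (localField f p E (extChartAt (𝓡 n) p q)) =
      g.val (f q) (E q) (E q) := by
    rw [← g.inChart_chartDeriv hfq]
    exact congrArg (fun q' ↦ g.inChart (f p) (extChartAt (𝓡 (n + 1)) (f p) (f q'))
      (chartDeriv (f p) (f q') (E q')) (chartDeriv (f p) (f q') (E q')))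
      (PartialEquiv.left_inv _ hq)
  have hcont : ContinuousAt (fun q ↦ g.val (f q) (E q) (E q)) p :=
    (g.contMDiffAt_val_apply hE.smooth.contMDiffAt hE.smooth.contMDiffAt).continuousAt
  have hsign : ∀ᶠ q in 𝓝 p, g.val (f q) (E q) (E q) = ε := by
    have h0 : 0 < ε * ε := by
      have := hE.unimodular p
      rw [← abs_mul_abs_self, this]
      norm_num
    have h1 : ∀ᶠ q in 𝓝 p, 0 < ε * g.val (f q) (E q) (E q) :=
      (continuousAt_const.mul hcont).eventually_const_lt h0
    filter_upwards [h1] with q hq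
    have h2 := hE.unimodular q
    have h3 := hE.unimodular p
    rcases abs_eq (zero_le_one) |>.1 h2 with h2 | h2 <;>
      rcases abs_eq (zero_le_one) |>.1 h3 with h3 | h3 <;> rw [← hε] at h3 <;>
      rw [h2, h3] at hq ⊢ <;> norm_num at hq
  have hsign' : ∀ᶠ x in 𝓝 (extChartAt (𝓡 n) p p), g.val (f ((extChartAt (𝓡 n) p).symm x))
      (E ((extChartAt (𝓡 n) p).symm x)) (E ((extChartAt (𝓡 n) p).symm x)) = ε := by
    have h := (continuousAt_extChartAt_symm (I := 𝓡 n) p).tendsto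
    rw [extChartAt_to_inv] at h
    exact h.eventually hsign
  obtain ⟨U, hU, hUo, hpU⟩ := mem_nhds_iff.1 (hsign'.and ((isOpen_chartDomain hf.continuous
    p).mem_nhds (self_mem_chartDomain (n := n) f p)))
  have hUd : U ⊆ chartDomain (n := n) f p := fun x hx ↦ (hU hx).2
  have lift {x : RSpace n} (hx : x ∈ U) : ∃ q, q ∈ (extChartAt (𝓡 n) p).source ∧
      f q ∈ (extChartAt (𝓡 (n + 1)) (f p)).source ∧ extChartAt (𝓡 n) p q = x ∧
      g.val (f q) (E q) (E q) = ε ∧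
      localMap f p x = extChartAt (𝓡 (n + 1)) (f p) (f q) ∧
      localField f p E x = chartDeriv (f p) (f q) (E q) :=
    ⟨_, PartialEquiv.map_target _ (hUd hx).1, (hUd hx).2, PartialEquiv.right_inv _ (hUd hx).1,
      (hU hx).1, rfl, rfl⟩
  refine ⟨U, hUd, hpU, hUo, ?_, ?_, ?_, ?_, ?_, ?_, ?_⟩
  · intro x hx
    obtain ⟨q, hq, hfq, rfl, -⟩ := lift hx
    exact contDiffAt_localMap hf hq hfq
  · intro x hx
    obtain ⟨q, hq, hfq, -, -, h, -⟩ := lift hx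
    rw [h]
    exact g.contDiffAt_inChart (PartialEquiv.map_source _ hfq)
  · exact fun _ ↦ .of_forall fun y v w ↦ g.inChart_symm y v w
  · intro x hx
    obtain ⟨q, hq, hfq, -, -, h, -⟩ := lift hx
    rw [h]
    exact g.isInvertible_inChart (PartialEquiv.map_source _ hfq)
  · intro x hx
    obtain ⟨q, hq, hfq, rfl, -⟩ := lift hx
    exact contDiffAt_localField hq hfq hE.smooth.contMDiffAt
  · intro x hx u
    obtain ⟨q, hq, hfq, rfl, -, h1, h2⟩ := lift hx
    obtain ⟨u, rfl⟩ := chartDeriv_surjective hq u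
    rw [fderiv_localMap_chartDeriv hf hq hfq, h1, h2, g.inChart_chartDeriv hfq, hE.orthogonal]
  · intro x hx
    obtain ⟨q, hq, hfq, rfl, h, -⟩ := lift hx
    rw [hnorm hfq hq, h]

end normal

end Hypersurface

/-! ### Contractions with a nondegenerate bilinear form -/

section algebra

variable {ι X : Type*} [Fintype ι] [DecidableEq ι] [AddCommGroup X] [Module ℝ X]
  (b : Module.Basis ι ℝ X) {Φ : X →ₗ[ℝ] X →ₗ[ℝ] ℝ}

theorem LinearMap.det_apply_basis_ne_zero (hΦ : ∀ u, (∀ v, Φ u v = 0) → u = 0) :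
    (Matrix.of fun i j ↦ Φ (b i) (b j)).det ≠ 0 := by
  intro h
  obtain ⟨v, hv, hv0⟩ := Matrix.exists_vecMul_eq_zero_iff.2 h
  refine hv ?_
  have h1 : ∑ i, v i • b i = 0 := by
    refine hΦ _ fun w ↦ ?_
    have h2 : Φ (∑ i, v i • b i) = 0 := by
      refine b.ext fun j ↦ ?_
      have := congrFun hv0 j
      simpa [Matrix.vecMul, dotProduct, LinearMap.sum_apply] using this
    rw [h2, LinearMap.zero_apply]
  funext i
  exact (Fintype.linearIndependent_iff.1 b.linearIndependent) v h1 i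

/-- Lowering and then raising an index is the identity: `Φ^{ij} Φ(b_j, w)` is the `i`-th coordinate
of `w`. -/
theorem LinearMap.sum_inv_mul_apply (hΦ : (Matrix.of fun i j ↦ Φ (b i) (b j)).det ≠ 0)
    (l : X →ₗ[ℝ] ℝ) (w : X) :
    ∑ i, ∑ j, (Matrix.of fun i j ↦ Φ (b i) (b j))⁻¹ i j * (l (b i) * Φ (b j) w) = l w := by
  set A : Matrix ι ι ℝ := Matrix.of fun i j ↦ Φ (b i) (b j) with hA
  have h (i : ι) : ∑ j, A⁻¹ i j * Φ (b j) w = b.repr w i := by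
    have h1 (j : ι) : Φ (b j) w = A.mulVec (b.repr w) j := by
      conv_lhs => rw [← b.sum_repr w]
      rw [map_sum]
      refine Finset.sum_congr rfl fun k _ ↦ ?_
      rw [map_smul, smul_eq_mul, mul_comm]
      rfl
    have h2 : A⁻¹.mulVec (A.mulVec (b.repr w)) = b.repr w := by
      rw [Matrix.mulVec_mulVec, Matrix.nonsing_inv_mul _ (isUnit_iff_ne_zero.2 hΦ),
        Matrix.one_mulVec]
    rw [← h2]
    exact Finset.sum_congr rfl fun j _ ↦ by rw [h1]
  calc ∑ i, ∑ j, A⁻¹ i j * (l (b i) * Φ (b j) w) = ∑ i, b.repr w i * l (b i) := by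
        refine Finset.sum_congr rfl fun i _ ↦ ?_
        rw [← h, Finset.sum_mul]
        exact Finset.sum_congr rfl fun j _ ↦ by ring
    _ = l w := by
        conv_rhs => rw [← b.sum_repr w, map_sum]
        exact Finset.sum_congr rfl fun i _ ↦ by rw [map_smul, smul_eq_mul]

theorem LinearMap.sum_inv_mul_self (hΦ : (Matrix.of fun i j ↦ Φ (b i) (b j)).det ≠ 0)
    (hs : ∀ u v, Φ u v = Φ v u) :
    ∑ i, ∑ j, (Matrix.of fun i j ↦ Φ (b i) (b j))⁻¹ i j * Φ (b i) (b j) = Fintype.card ι := by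
  set A : Matrix ι ι ℝ := Matrix.of fun i j ↦ Φ (b i) (b j) with hA
  have h : ∀ i, ∑ j, A⁻¹ i j * Φ (b i) (b j) = 1 := fun i ↦ by
    have h1 : (A⁻¹ * A) i i = 1 := by
      rw [Matrix.nonsing_inv_mul _ (isUnit_iff_ne_zero.2 hΦ), Matrix.one_apply_eq]
    rw [← h1, Matrix.mul_apply]
    exact Finset.sum_congr rfl fun j _ ↦ by rw [hs (b i) (b j)]; rfl
  simp [h]

/-- The effect of a change of transverse field on the alignment condition. Here `T` is the
covariant derivative of the second fundamental form `Φ` for a field satisfying the Codazzi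
equation, and `D` that for a field with coefficient `a` and tangential part `z` relative to it. -/
theorem LinearMap.trace_eq_of_aligned {n : ℕ} (hn : 2 ≤ n) (b : Module.Basis (Fin n) ℝ X)
    (hs : ∀ u v, Φ u v = Φ v u) (hΦ : (Matrix.of fun i j ↦ Φ (b i) (b j)).det ≠ 0)
    {T D : X → X → X → ℝ} (hT : ∀ u v w, T u v w = T v u w) (hT' : ∀ u v w, T u v w = T u w v)
    {a : ℝ} (ha : a ≠ 0) {l : X →ₗ[ℝ] ℝ} {z w : X}
    (hD : ∀ u v w, D u v w = a⁻¹ * T u v w - l u * (a ^ 2)⁻¹ * Φ v w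
      + (a ^ 2)⁻¹ * (Φ u v * Φ z w + Φ u w * Φ v z))
    (hal : (n : ℝ) * ∑ i, ∑ j, (Matrix.of fun i j ↦ a⁻¹ * Φ (b i) (b j))⁻¹ i j *
        D (b i) (b j) w =
      ∑ i, ∑ j, (Matrix.of fun i j ↦ a⁻¹ * Φ (b i) (b j))⁻¹ i j * D w (b i) (b j)) :
    ∑ i, ∑ j, (Matrix.of fun i j ↦ Φ (b i) (b j))⁻¹ i j * T w (b i) (b j) =
      -(((n : ℝ) + 2) / a * Φ z w) := by
  set A : Matrix (Fin n) (Fin n) ℝ := Matrix.of fun i j ↦ Φ (b i) (b j) with hA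
  have hinv : (Matrix.of fun i j ↦ a⁻¹ * Φ (b i) (b j))⁻¹ = a • A⁻¹ := by
    have h1 : (Matrix.of fun i j ↦ a⁻¹ * Φ (b i) (b j)) = a⁻¹ • A := rfl
    rw [h1]
    refine Matrix.inv_eq_left_inv ?_
    rw [Matrix.smul_mul, Matrix.mul_smul, Matrix.nonsing_inv_mul _ (isUnit_iff_ne_zero.2 hΦ),
      smul_smul, mul_inv_cancel₀ ha, one_smul]
  rw [hinv] at hal
  have s1 := LinearMap.sum_inv_mul_self b hΦ hs
  have s2 := LinearMap.sum_inv_mul_apply b hΦ l w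
  have s3 := LinearMap.sum_inv_mul_apply b hΦ (Φ w) z
  rw [Fintype.card_fin] at s1
  have e1 : ∑ i, ∑ j, (a • A⁻¹) i j * D (b i) (b j) w =
      ∑ i, ∑ j, A⁻¹ i j * T w (b i) (b j) - a⁻¹ * ∑ i, ∑ j, A⁻¹ i j * (l (b i) * Φ (b j) w)
        + a⁻¹ * ((∑ i, ∑ j, A⁻¹ i j * Φ (b i) (b j)) * Φ z w
          + ∑ i, ∑ j, A⁻¹ i j * (Φ w (b i) * Φ (b j) z)) := by
    simp only [Finset.sum_mul, Finset.mul_sum, ← Finset.sum_add_distrib, ← Finset.sum_sub_distrib]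
    refine Finset.sum_congr rfl fun i _ ↦ Finset.sum_congr rfl fun j _ ↦ ?_
    -- Total symmetry of `T` moves `w` to the first slot, so both sides of the alignment condition
    -- contain the same trace of `T`.
    rw [hD, Matrix.smul_apply, smul_eq_mul, hT' (b i) (b j) w, hT (b i) w, hs (b i) w]
    field_simp
  have e2 : ∑ i, ∑ j, (a • A⁻¹) i j * D w (b i) (b j) =
      ∑ i, ∑ j, A⁻¹ i j * T w (b i) (b j) - a⁻¹ * l w * (∑ i, ∑ j, A⁻¹ i j * Φ (b i) (b j))
        + 2 * a⁻¹ * ∑ i, ∑ j, A⁻¹ i j * (Φ w (b i) * Φ (b j) z) := by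
    have hsymm : ∑ i, ∑ j, A⁻¹ i j * (Φ w (b i) * Φ (b j) z) =
        ∑ i, ∑ j, A⁻¹ i j * (Φ w (b j) * Φ (b i) z) := by
      rw [Finset.sum_comm]
      have hAt : A⁻¹.transpose = A⁻¹ := by
        rw [Matrix.transpose_nonsing_inv]
        congr 1
        ext i j
        exact hs _ _
      refine Finset.sum_congr rfl fun i _ ↦ Finset.sum_congr rfl fun j _ ↦ ?_
      rw [← congrFun (congrFun hAt i) j]
      rfl
    rw [two_mul, add_mul]
    nth_rewrite 2 [hsymm]
    simp only [Finset.mul_sum, ← Finset.sum_add_distrib, ← Finset.sum_sub_distrib]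
    refine Finset.sum_congr rfl fun i _ ↦ Finset.sum_congr rfl fun j _ ↦ ?_
    rw [hD, Matrix.smul_apply, smul_eq_mul, hs z (b j)]
    field_simp
  -- With `t` the trace of `T`, alignment reads `n (t - l w / a + (n + 1) Φ(z, w) / a) = t - n l w /
  -- a + 2 Φ(z, w) / a`. The terms in `l` cancel, and `n² + n - 2 = (n - 1)(n + 2)`; dividing by `n
  -- - 1` needs `n ≠ 1`.
  rw [e1, e2, s1, s2, s3, hs w z] at hal
  set t := ∑ i, ∑ j, A⁻¹ i j * T w (b i) (b j)
  have hn1 : (n : ℝ) - 1 ≠ 0 := by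
    have : (2 : ℝ) ≤ n := by exact_mod_cast hn
    linarith
  refine mul_left_cancel₀ hn1 ?_
  rw [div_eq_mul_inv]
  linear_combination hal

end algebra

/-! ### Fundamental forms and shape operator of the unimodular normal -/

namespace Hypersurface

open Filter Topology

variable {n : ℕ} {M : Type*} [TopologicalSpace M] [ChartedSpace (RSpace (n + 1)) M]
  [IsManifold (𝓡 (n + 1)) ∞ M]
  {S : Type*} [TopologicalSpace S] [ChartedSpace (RSpace n) S] [IsManifold (𝓡 n) ∞ S]
  {f : S → M} {p q : S} {N E ν : (p : S) → TangentSpace (𝓡 (n + 1)) (f p)}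

theorem localMap_chart (hq : q ∈ (extChartAt (𝓡 n) p).source) :
    localMap f p (extChartAt (𝓡 n) p q) = extChartAt (𝓡 (n + 1)) (f p) (f q) := by
  rw [localMap, PartialEquiv.left_inv _ hq]

theorem localField_chart (hq : q ∈ (extChartAt (𝓡 n) p).source)
    (W : (p : S) → TangentSpace (𝓡 (n + 1)) (f p)) :
    localField f p W (extChartAt (𝓡 n) p q) = chartDeriv (f p) (f q) (W q) :=
  congrArg (fun q' ↦ chartDeriv (f p) (f q') (W q')) (PartialEquiv.left_inv _ hq)

/-- Substitute `E = a⁻¹ (N - f_* z)` in the decomposition of `ξ` relative to `E`; the decomposition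
relative to `N` is unique. -/
theorem tangentialPart_eq_of_eq_smul_add
    (hf : Function.Injective (mfderiv (𝓡 n) (𝓡 (n + 1)) f p))
    (hN : N p ∉ Set.range (mfderiv (𝓡 n) (𝓡 (n + 1)) f p))
    (hE : E p ∉ Set.range (mfderiv (𝓡 n) (𝓡 (n + 1)) f p)) {a : ℝ} (ha : a ≠ 0)
    {z : TangentSpace (𝓡 n) p} (h : N p = a • E p + mfderiv (𝓡 n) (𝓡 (n + 1)) f p z)
    (ξ : TangentSpace (𝓡 (n + 1)) (f p)) :
    tangentialPart f N p ξ = tangentialPart f E p ξ - (a⁻¹ * transversePart f E p ξ) • z ∧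
      transversePart f N p ξ = a⁻¹ * transversePart f E p ξ := by
  have hξ : ξ = mfderiv (𝓡 n) (𝓡 (n + 1)) f p
      (tangentialPart f E p ξ - (a⁻¹ * transversePart f E p ξ) • z) +
        (a⁻¹ * transversePart f E p ξ) • N p := by
    conv_lhs => rw [← tangentialPart_add_transversePart hf hE ξ]
    have h1 : a⁻¹ * transversePart f E p ξ * a = transversePart f E p ξ := by
      field_simp
    rw [h, map_sub, map_smul, smul_add, smul_smul, h1]
    abel
  constructor
  · conv_lhs => rw [hξ, tangentialPart_apply hf hN]
  · conv_lhs => rw [hξ, transversePart_apply hf hN]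

namespace IsUnimodularNormal

variable {g : PseudoRiemannianMetric (n + 1) M}

theorem mul_self_eq_one (hE : IsUnimodularNormal g f ν E) (p : S) :
    g.val (f p) (E p) (E p) * g.val (f p) (E p) (E p) = 1 := by
  rw [← abs_mul_abs_self, hE.unimodular, one_mul]

/-- Pair the decomposition of `ξ` with `E`: the tangential part drops out, and `g(E, E)` is its own
inverse. -/
theorem transversePart_eq (hE : IsUnimodularNormal g f ν E)
    (hf : Function.Injective (mfderiv (𝓡 n) (𝓡 (n + 1)) f p))
    (hEt : E p ∉ Set.range (mfderiv (𝓡 n) (𝓡 (n + 1)) f p))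
    (ξ : TangentSpace (𝓡 (n + 1)) (f p)) :
    transversePart f E p ξ = g.val (f p) (E p) (E p) * g.val (f p) (E p) ξ := by
  have h := congrArg (g.val (f p) (E p)) (tangentialPart_add_transversePart hf hEt ξ)
  rw [map_add, hE.orthogonal, map_smul, zero_add, smul_eq_mul] at h
  rw [← h, mul_left_comm, hE.mul_self_eq_one, mul_one]

section chart

variable {U : Set (RSpace n)} {ε : ℝ}

theorem eq_of_isNormalField
    (h : LocalMetric.IsNormalField (g.inChart (f p)) (localMap f p) (localField f p E) ε U)
    (hq : q ∈ (extChartAt (𝓡 n) p).source) (hfq : f q ∈ (extChartAt (𝓡 (n + 1)) (f p)).source)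
    (hqU : extChartAt (𝓡 n) p q ∈ U) :
    g.val (f q) (E q) (E q) = ε := by
  rw [← g.inChart_chartDeriv hfq, ← h.norm hqU, localMap_chart hq, localField_chart hq]

/-- Valid at all `q` near `p`, which is what allows differentiation at `p`. The term coming from the
choice of extension is tangential and is killed by `E`. -/
theorem secondForm_eq_local (hE : IsUnimodularNormal g f ν E) (hf : IsSmoothImmersion n f)
    (hEt : E q ∉ Set.range (mfderiv (𝓡 n) (𝓡 (n + 1)) f q))
    (h : LocalMetric.IsNormalField (g.inChart (f p)) (localMap f p) (localField f p E) ε U)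
    (hq : q ∈ (extChartAt (𝓡 n) p).source) (hfq : f q ∈ (extChartAt (𝓡 (n + 1)) (f p)).source)
    (hqU : extChartAt (𝓡 n) p q ∈ U) (u v : TangentSpace (𝓡 n) q) :
    secondForm g f E q u v = LocalMetric.secondForm (g.inChart (f p)) (localMap f p)
      (localField f p E) ε (extChartAt (𝓡 n) p q) (chartDeriv p q u) (chartDeriv p q v) := by
  rw [secondForm, hE.transversePart_eq (hf.2 q) hEt, eq_of_isNormalField h hq hfq hqU,
    ← g.inChart_chartDeriv hfq, chartDeriv_covDerivAlong_pushforward g hf.1 hq hfq,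
    ← localMap_chart hq, ← localField_chart hq, map_add, h.orthogonal hqU, add_zero]
  rfl

theorem firstForm_eq_local (hf : IsSmoothImmersion n f)
    (hq : q ∈ (extChartAt (𝓡 n) p).source) (hfq : f q ∈ (extChartAt (𝓡 (n + 1)) (f p)).source)
    (u v : TangentSpace (𝓡 n) q) :
    g.val (f q) (mfderiv (𝓡 n) (𝓡 (n + 1)) f q u) (mfderiv (𝓡 n) (𝓡 (n + 1)) f q v) =
      LocalMetric.firstForm (g.inChart (f p)) (localMap f p)
        (extChartAt (𝓡 n) p q) (chartDeriv p q u) (chartDeriv p q v) := by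
  rw [LocalMetric.firstForm, fderiv_localMap_chartDeriv hf.1 hq hfq,
    fderiv_localMap_chartDeriv hf.1 hq hfq, localMap_chart hq, g.inChart_chartDeriv hfq]

/-- For `E` the one-form `τ` vanishes, because `g(E, E)` is locally constant; nothing is lost in
taking the tangential part. -/
theorem mfderiv_shapeOperator (hE : IsUnimodularNormal g f ν E) (hf : IsSmoothImmersion n f)
    (hEt : E q ∉ Set.range (mfderiv (𝓡 n) (𝓡 (n + 1)) f q))
    (h : LocalMetric.IsNormalField (g.inChart (f p)) (localMap f p) (localField f p E) ε U)
    (hq : q ∈ (extChartAt (𝓡 n) p).source) (hfq : f q ∈ (extChartAt (𝓡 (n + 1)) (f p)).source)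
    (hqU : extChartAt (𝓡 n) p q ∈ U) (u : TangentSpace (𝓡 n) q) :
    mfderiv (𝓡 n) (𝓡 (n + 1)) f q (shapeOperator g f E q u) = -covDerivAlong g f E q u := by
  have h1 : transversePart f E q (covDerivAlong g f E q u) = 0 := by
    rw [hE.transversePart_eq (hf.2 q) hEt, ← g.inChart_chartDeriv hfq (E q) (covDerivAlong g f E q u),
      chartDeriv_covDerivAlong g hf.1 hq hfq hE.smooth.contMDiffAt,
      ← localMap_chart hq, ← localField_chart hq, g.inChart_symm, h.apply_covDeriv_normal hqU,
      mul_zero]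
  have h2 := tangentialPart_add_transversePart (hf.2 q) hEt (covDerivAlong g f E q u)
  rw [h1, zero_smul, add_zero] at h2
  have h3 : shapeOperator g f E q u = -tangentialPart f E q (covDerivAlong g f E q u) := rfl
  rw [h3, map_neg, h2]

theorem secondForm_eq_shapeOperator (hE : IsUnimodularNormal g f ν E)
    (hf : IsSmoothImmersion n f)
    (hEt : E q ∉ Set.range (mfderiv (𝓡 n) (𝓡 (n + 1)) f q))
    (h : LocalMetric.IsNormalField (g.inChart (f p)) (localMap f p) (localField f p E) ε U)
    (hq : q ∈ (extChartAt (𝓡 n) p).source) (hfq : f q ∈ (extChartAt (𝓡 (n + 1)) (f p)).source)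
    (hqU : extChartAt (𝓡 n) p q ∈ U) (u v : TangentSpace (𝓡 n) q) :
    secondForm g f E q u v =
      ε * g.val (f q) (mfderiv (𝓡 n) (𝓡 (n + 1)) f q (shapeOperator g f E q u))
        (mfderiv (𝓡 n) (𝓡 (n + 1)) f q v) := by
  rw [hE.secondForm_eq_local hf hEt h hq hfq hqU, hE.mfderiv_shapeOperator hf hEt h hq hfq hqU,
    ← g.inChart_chartDeriv hfq, map_neg, chartDeriv_covDerivAlong g hf.1 hq hfq
    hE.smooth.contMDiffAt, ← fderiv_localMap_chartDeriv hf.1 hq hfq, ← localMap_chart hq, map_neg,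
    neg_apply, h.apply_covDeriv_tangent hqU, neg_neg]
  rfl

/-- The Gauss-Kronecker curvature is the quotient of the determinants of the second and the first
fundamental forms. -/
theorem gaussKroneckerCurvature_mul_det (hE : IsUnimodularNormal g f ν E)
    (hf : IsSmoothImmersion n f)
    (hEt : E q ∉ Set.range (mfderiv (𝓡 n) (𝓡 (n + 1)) f q))
    (h : LocalMetric.IsNormalField (g.inChart (f p)) (localMap f p) (localField f p E) ε U)
    (hq : q ∈ (extChartAt (𝓡 n) p).source) (hfq : f q ∈ (extChartAt (𝓡 (n + 1)) (f p)).source)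
    (hqU : extChartAt (𝓡 n) p q ∈ U) (b : Module.Basis (Fin n) ℝ (TangentSpace (𝓡 n) q)) :
    (Matrix.of fun i j ↦ secondForm g f E q (b i) (b j)).det =
      ε ^ n * gaussKroneckerCurvature g f E q *
        (Matrix.of fun i j ↦ g.val (f q) (mfderiv (𝓡 n) (𝓡 (n + 1)) f q (b i))
          (mfderiv (𝓡 n) (𝓡 (n + 1)) f q (b j))).det := by
  set A := LinearMap.toMatrix b b (shapeOperator g f E q).toLinearMap with hA
  -- The relation `h(u, v) = ε I(S u, v)` in matrix form; the factor `ε^n` comes from the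
  -- determinant of a scalar multiple.
  have h1 : (Matrix.of fun i j ↦ secondForm g f E q (b i) (b j)) =
      ε • (A.transpose * (Matrix.of fun i j ↦ g.val (f q) (mfderiv (𝓡 n) (𝓡 (n + 1)) f q (b i))
          (mfderiv (𝓡 n) (𝓡 (n + 1)) f q (b j)))) := by
    ext i j
    have hS : shapeOperator g f E q (b i) = ∑ k, A k i • b k := by
      conv_lhs => rw [← b.sum_repr (shapeOperator g f E q (b i))]
      refine Finset.sum_congr rfl fun k _ ↦ ?_
      rw [hA, LinearMap.toMatrix_apply]
      rfl
    rw [Matrix.of_apply, hE.secondForm_eq_shapeOperator hf hEt h hq hfq hqU, hS, map_sum, map_sum,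
      Matrix.smul_apply, Matrix.mul_apply, sum_apply]
    refine congrArg (ε * ·) (Finset.sum_congr rfl fun k _ ↦ ?_)
    rw [map_smul, map_smul]
    rfl
  rw [h1, Matrix.det_smul, Matrix.det_mul, Matrix.det_transpose, hA, LinearMap.det_toMatrix,
    Fintype.card_fin, gaussKroneckerCurvature, mul_assoc]

end chart

end IsUnimodularNormal

end Hypersurface

/-! ### The Codazzi equation and the derivative of the curvature on the manifold -/

namespace Hypersurface

open Filter Topology

variable {n : ℕ} {M : Type*} [TopologicalSpace M] [ChartedSpace (RSpace (n + 1)) M]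
  [IsManifold (𝓡 (n + 1)) ∞ M]
  {S : Type*} [TopologicalSpace S] [ChartedSpace (RSpace n) S] [IsManifold (𝓡 n) ∞ S]
  {f : S → M} {p q : S} {N E ν : (p : S) → TangentSpace (𝓡 (n + 1)) (f p)}
  {g : PseudoRiemannianMetric (n + 1) M}

/-- The induced connection at `p`, in the preferred chart at `p`. -/
def localConnection (g : PseudoRiemannianMetric (n + 1) M) (f : S → M)
    (E : (p : S) → TangentSpace (𝓡 (n + 1)) (f p)) (p : S) (a b : RSpace n) : RSpace n :=
  inducedConnection g f E (extendVector (p := p) b) p a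

theorem localConnection_chartDeriv (u v : TangentSpace (𝓡 n) p) :
    localConnection g f E p (chartDeriv p p u) (chartDeriv p p v) =
      chartDeriv p p (inducedConnection g f E (extendVector v) p u) := by
  rw [chartDeriv_self, chartDeriv_self, chartDeriv_self]
  rfl

namespace IsUnimodularNormal

variable {U : Set (RSpace n)} {ε : ℝ}

/-- The Gauss formula, in the form of the hypothesis `hC` of the coordinate lemmas; it is needed
only at the base point. -/
theorem localConnection_add_secondForm (hE : IsUnimodularNormal g f ν E)
    (hf : IsSmoothImmersion n f)
    (hEt : E p ∉ Set.range (mfderiv (𝓡 n) (𝓡 (n + 1)) f p))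
    (h : LocalMetric.IsNormalField (g.inChart (f p)) (localMap f p) (localField f p E) ε U)
    (hpU : extChartAt (𝓡 n) p p ∈ U) (u v : RSpace n) :
    fderiv ℝ (localMap f p) (extChartAt (𝓡 n) p p) (localConnection g f E p u v) +
        LocalMetric.secondForm (g.inChart (f p)) (localMap f p) (localField f p E) ε
          (extChartAt (𝓡 n) p p) u v • localField f p E (extChartAt (𝓡 n) p p) =
      LocalMetric.covHessian (g.inChart (f p)) (localMap f p) (extChartAt (𝓡 n) p p) u v := by
  have hp := mem_extChartAt_source (I := 𝓡 n) p
  have hfp := mem_extChartAt_source (I := 𝓡 (n + 1)) (f p)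
  obtain ⟨u, rfl⟩ := chartDeriv_surjective hp u
  obtain ⟨v, rfl⟩ := chartDeriv_surjective hp v
  rw [localConnection_chartDeriv, fderiv_localMap_chartDeriv hf.1 hp hfp,
    ← hE.secondForm_eq_local hf hEt h hp hfp hpU, localField_chart hp, ← map_smul, ← map_add,
    ← chartDeriv_covDerivAlong_pushforward_self g hf.1 u v]
  exact congrArg _ (tangentialPart_add_transversePart (hf.2 p) hEt _)

theorem secondForm_extendVector_eventuallyEq (hE : IsUnimodularNormal g f ν E)
    (hf : IsSmoothImmersion n f)
    (hEt : ∀ q, E q ∉ Set.range (mfderiv (𝓡 n) (𝓡 (n + 1)) f q))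
    (h : LocalMetric.IsNormalField (g.inChart (f p)) (localMap f p) (localField f p E) ε U)
    (hUd : U ⊆ chartDomain (n := n) f p)
    (hpU : extChartAt (𝓡 n) p p ∈ U) (v w : TangentSpace (𝓡 n) p) :
    (fun x ↦ secondForm g f E ((extChartAt (𝓡 n) p).symm x) (extendVector v _)
        (extendVector w _)) =ᶠ[𝓝 (extChartAt (𝓡 n) p p)]
      fun x ↦ LocalMetric.secondForm (g.inChart (f p)) (localMap f p) (localField f p E) ε x
        (chartDeriv p p v) (chartDeriv p p w) := by
  filter_upwards [h.isOpen.mem_nhds hpU] with x hx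
  have hq := PartialEquiv.map_target _ (hUd hx).1
  have hx' := PartialEquiv.right_inv _ (hUd hx).1
  rw [hE.secondForm_eq_local hf (hEt _) h hq (hUd hx).2 (by rwa [hx']), hx', extendVector,
    extendVector, chartDeriv_extendVector hq, chartDeriv_extendVector hq, chartDeriv_self,
    chartDeriv_self]

theorem covDerivSecondForm_eq_local (hE : IsUnimodularNormal g f ν E)
    (hf : IsSmoothImmersion n f)
    (hEt : ∀ q, E q ∉ Set.range (mfderiv (𝓡 n) (𝓡 (n + 1)) f q))
    (h : LocalMetric.IsNormalField (g.inChart (f p)) (localMap f p) (localField f p E) ε U)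
    (hUd : U ⊆ chartDomain (n := n) f p)
    (hpU : extChartAt (𝓡 n) p p ∈ U) (u v w : TangentSpace (𝓡 n) p) :
    covDerivSecondForm g f E p u v w =
      LocalMetric.covDerivSecondForm (g.inChart (f p)) (localMap f p) (localField f p E) ε
        (extChartAt (𝓡 n) p p) (localConnection g f E p) (chartDeriv p p u) (chartDeriv p p v)
        (chartDeriv p p w) := by
  have hp := mem_extChartAt_source (I := 𝓡 n) p
  have hfp := mem_extChartAt_source (I := 𝓡 (n + 1)) (f p)
  have hev := hE.secondForm_extendVector_eventuallyEq hf hEt h hUd hpU v w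
  have hd := (h.differentiableAt_secondForm hpU (chartDeriv p p v) (chartDeriv p p
    w)).congr_of_eventuallyEq hev
  have h1 := mvfderiv_eq_fderiv_comp_chartDeriv
    (h := fun q ↦ secondForm g f E q (extendVector v q) (extendVector w q)) hp hd
  rw [hev.fderiv_eq] at h1
  rw [covDerivSecondForm, h1, hE.secondForm_eq_local hf (hEt p) h hp hfp hpU,
    hE.secondForm_eq_local hf (hEt p) h hp hfp hpU, LocalMetric.covDerivSecondForm,
    localConnection_chartDeriv, localConnection_chartDeriv]
  rfl

/-- The second fundamental form is a symmetric bilinear form. -/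
theorem exists_secondForm_bilin (hE : IsUnimodularNormal g f ν E) (hf : IsSmoothImmersion n f)
    (hEt : ∀ q, E q ∉ Set.range (mfderiv (𝓡 n) (𝓡 (n + 1)) f q)) (p : S) :
    ∃ Φ : TangentSpace (𝓡 n) p →ₗ[ℝ] TangentSpace (𝓡 n) p →ₗ[ℝ] ℝ,
      (∀ u v, Φ u v = secondForm g f E p u v) ∧ ∀ u v, Φ u v = Φ v u := by
  obtain ⟨U, hUd, hpU, h⟩ := hE.exists_isNormalField hf.1 p
  have hp := mem_extChartAt_source (I := 𝓡 n) p
  have hfp := mem_extChartAt_source (I := 𝓡 (n + 1)) (f p)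
  refine ⟨(LocalMetric.secondFormBilin (g.inChart (f p)) (localMap f p) (localField f p E)
    (g.val (f p) (E p) (E p)) (extChartAt (𝓡 n) p p)).compl₁₂ (chartDeriv p p).toLinearMap
      (chartDeriv p p).toLinearMap, fun u v ↦ ?_, fun u v ↦ ?_⟩
  · exact (hE.secondForm_eq_local hf (hEt p) h hp hfp hpU u v).symm
  · exact h.secondForm_symm hpU _ _

end IsUnimodularNormal

theorem IsAffinelyNondegenerate.eq_zero (haff : IsAffinelyNondegenerate g f)
    (hf : IsSmoothImmersion n f) (hEt : E p ∉ Set.range (mfderiv (𝓡 n) (𝓡 (n + 1)) f p))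
    {u : TangentSpace (𝓡 n) p} (hu : ∀ v, secondForm g f E p u v = 0) : u = 0 := by
  refine haff p u fun v ↦
    ⟨tangentialPart f E p (covDerivAlong g f (pushforward f (extendVector v)) p u), ?_⟩
  have h1 := tangentialPart_add_transversePart (hf.2 p) hEt
    (covDerivAlong g f (pushforward f (extendVector v)) p u)
  have h2 : transversePart f E p (covDerivAlong g f (pushforward f (extendVector v)) p u) = 0 :=
    hu v
  rwa [h2, zero_smul, add_zero] at h1

/-- The only place where constant curvature enters: the curvature of tangent vectors is then a
combination of two of them, hence orthogonal to `E`. -/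
theorem _root_.PseudoRiemannianMetric.HasConstantCurvature.inChart_curvature_eq_zero {c : ℝ}
    (hg : g.HasConstantCurvature c) (h : ∀ u, g.inChart (f p) (localMap f p (extChartAt (𝓡 n) p p))
      (localField f p E (extChartAt (𝓡 n) p p))
      (fderiv ℝ (localMap f p) (extChartAt (𝓡 n) p p) u) = 0) (u v w : RSpace n) :
    g.inChart (f p) (localMap f p (extChartAt (𝓡 n) p p))
      (localField f p E (extChartAt (𝓡 n) p p))
      (LocalMetric.curvature (g.inChart (f p)) (localMap f p (extChartAt (𝓡 n) p p))
        (fderiv ℝ (localMap f p) (extChartAt (𝓡 n) p p) u)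
        (fderiv ℝ (localMap f p) (extChartAt (𝓡 n) p p) v)
        (fderiv ℝ (localMap f p) (extChartAt (𝓡 n) p p) w)) = 0 := by
  have hp := mem_extChartAt_source (I := 𝓡 n) p
  have h1 (a b c' : RSpace (n + 1)) : LocalMetric.curvature (g.inChart (f p))
      (localMap f p (extChartAt (𝓡 n) p p)) a b c' = c •
        (g.inChart (f p) (localMap f p (extChartAt (𝓡 n) p p)) b c' • a -
          g.inChart (f p) (localMap f p (extChartAt (𝓡 n) p p)) a c' • b) := by
    rw [localMap_chart hp]
    exact hg (f p) a b c'
  rw [h1, map_smul, map_sub, map_smul, map_smul, h, h]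
  simp

theorem IsMetricallyNondegenerate.det_firstForm_ne_zero (hmet : IsMetricallyNondegenerate g f)
    (b : Module.Basis (Fin n) ℝ (TangentSpace (𝓡 n) p)) :
    (Matrix.of fun i j ↦ g.val (f p) (mfderiv (𝓡 n) (𝓡 (n + 1)) f p (b i))
      (mfderiv (𝓡 n) (𝓡 (n + 1)) f p (b j))).det ≠ 0 := by
  let Φ : TangentSpace (𝓡 n) p →ₗ[ℝ] TangentSpace (𝓡 n) p →ₗ[ℝ] ℝ :=
    LinearMap.mk₂ ℝ (fun u v ↦ g.val (f p) (mfderiv (𝓡 n) (𝓡 (n + 1)) f p u)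
      (mfderiv (𝓡 n) (𝓡 (n + 1)) f p v)) (by simp) (by simp) (by simp) (by simp)
  exact LinearMap.det_apply_basis_ne_zero (Φ := Φ) b (hmet p)

namespace IsUnimodularNormal

/-- The Codazzi equation. -/
theorem covDerivSecondForm_symm (hE : IsUnimodularNormal g f ν E) (hf : IsSmoothImmersion n f)
    (hEt : ∀ q, E q ∉ Set.range (mfderiv (𝓡 n) (𝓡 (n + 1)) f q))
    {c : ℝ} (hg : g.HasConstantCurvature c) (u v w : TangentSpace (𝓡 n) p) :
    covDerivSecondForm g f E p u v w = covDerivSecondForm g f E p u w v ∧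
      covDerivSecondForm g f E p u v w = covDerivSecondForm g f E p v u w := by
  obtain ⟨U, hUd, hpU, h⟩ := hE.exists_isNormalField hf.1 p
  have hp := mem_extChartAt_source (I := 𝓡 n) p
  have hfp := mem_extChartAt_source (I := 𝓡 (n + 1)) (f p)
  simp only [hE.covDerivSecondForm_eq_local hf hEt h hUd hpU]
  refine ⟨h.covDerivSecondForm_symm hpU _ _ _, h.covDerivSecondForm_comm hpU ?_
    (hE.localConnection_add_secondForm hf (hEt p) h hpU)
    (hg.inChart_curvature_eq_zero (h.orthogonal hpU)) _ _ _⟩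
  intro a b hab
  obtain ⟨a, rfl⟩ := chartDeriv_surjective hp a
  obtain ⟨b, rfl⟩ := chartDeriv_surjective hp b
  rw [fderiv_localMap_chartDeriv hf.1 hp hfp, fderiv_localMap_chartDeriv hf.1 hp hfp] at hab
  rw [hf.2 p (chartDeriv_injective hfp hab)]

theorem det_secondForm_ne_zero (hE : IsUnimodularNormal g f ν E) (hf : IsSmoothImmersion n f)
    (hEt : ∀ q, E q ∉ Set.range (mfderiv (𝓡 n) (𝓡 (n + 1)) f q))
    (haff : IsAffinelyNondegenerate g f) (b : Module.Basis (Fin n) ℝ (TangentSpace (𝓡 n) p)) :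
    (Matrix.of fun i j ↦ secondForm g f E p (b i) (b j)).det ≠ 0 := by
  obtain ⟨Φ, hΦ, -⟩ := hE.exists_secondForm_bilin hf hEt p
  simp only [← hΦ]
  exact LinearMap.det_apply_basis_ne_zero b fun u hu ↦
    haff.eq_zero hf (hEt p) fun v ↦ by rw [← hΦ, hu]

/-- The logarithmic derivative of the Gauss-Kronecker curvature. -/
theorem fderiv_gaussKroneckerCurvature (hE : IsUnimodularNormal g f ν E)
    (hf : IsSmoothImmersion n f)
    (hEt : ∀ q, E q ∉ Set.range (mfderiv (𝓡 n) (𝓡 (n + 1)) f q))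
    (haff : IsAffinelyNondegenerate g f) (hmet : IsMetricallyNondegenerate g f)
    (b : Module.Basis (Fin n) ℝ (TangentSpace (𝓡 n) p)) :
    DifferentiableAt ℝ (fun x ↦ gaussKroneckerCurvature g f E ((extChartAt (𝓡 n) p).symm x))
        (extChartAt (𝓡 n) p p) ∧
      ∀ w, fderiv ℝ (fun x ↦ gaussKroneckerCurvature g f E ((extChartAt (𝓡 n) p).symm x))
          (extChartAt (𝓡 n) p p) (chartDeriv p p w) =
        gaussKroneckerCurvature g f E p *
          ∑ i, ∑ j, (Matrix.of fun i j ↦ secondForm g f E p (b i) (b j))⁻¹ i j *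
            covDerivSecondForm g f E p w (b i) (b j) := by
  obtain ⟨U, hUd, hpU, h⟩ := hE.exists_isNormalField hf.1 p
  have hp := mem_extChartAt_source (I := 𝓡 n) p
  have hfp := mem_extChartAt_source (I := 𝓡 (n + 1)) (f p)
  set ε := g.val (f p) (E p) (E p) with hε
  obtain ⟨e, he⟩ := isInvertible_chartDeriv hp
  set b' : Module.Basis (Fin n) ℝ (RSpace n) := b.map e.toLinearEquiv with hb'
  have hbb (i : Fin n) : b' i = chartDeriv p p (b i) := by
    rw [← he]
    exact Module.Basis.map_apply b _ i
  have hI0 : (Matrix.of fun i j ↦ LocalMetric.firstForm (g.inChart (f p)) (localMap f p)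
      (extChartAt (𝓡 n) p p) (b' i) (b' j)).det ≠ 0 := by
    simp only [hbb, ← firstForm_eq_local hf hp hfp]
    exact hmet.det_firstForm_ne_zero b
  have hH0 : (Matrix.of fun i j ↦ LocalMetric.secondForm (g.inChart (f p)) (localMap f p)
      (localField f p E) ε (extChartAt (𝓡 n) p p) (b' i) (b' j)).det ≠ 0 := by
    simp only [hbb, ← hE.secondForm_eq_local hf (hEt p) h hp hfp hpU]
    exact hE.det_secondForm_ne_zero hf hEt haff b
  -- This is `det h = ε^n K det I` multiplied by `ε^n`, using `ε² = 1`; hence the constant `κ =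
  -- ε^n`.
  have hk : ∀ᶠ x in 𝓝 (extChartAt (𝓡 n) p p),
      gaussKroneckerCurvature g f E ((extChartAt (𝓡 n) p).symm x) *
        (Matrix.of fun i j ↦ LocalMetric.firstForm (g.inChart (f p)) (localMap f p)
          x (b' i) (b' j)).det = ε ^ n *
        (Matrix.of fun i j ↦ LocalMetric.secondForm (g.inChart (f p)) (localMap f p)
          (localField f p E) ε x (b' i) (b' j)).det := by
    filter_upwards [h.isOpen.mem_nhds hpU] with x hx
    have hq := PartialEquiv.map_target _ (hUd hx).1
    have hx' := PartialEquiv.right_inv _ (hUd hx).1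
    obtain ⟨e', he'⟩ := isInvertible_chartDeriv hq
    have h1 := hE.gaussKroneckerCurvature_mul_det hf (hEt _) h hq (hUd hx).2 (by rwa [hx'])
      (b'.map e'.symm.toLinearEquiv)
    have h2 (i : Fin n) : chartDeriv p ((extChartAt (𝓡 n) p).symm x)
        (b'.map e'.symm.toLinearEquiv i) = b' i := by
      rw [← he']
      exact e'.apply_symm_apply _
    simp only [firstForm_eq_local hf hq (hUd hx).2,
      hE.secondForm_eq_local hf (hEt _) h hq (hUd hx).2 (by rwa [hx']), h2, hx'] at h1
    rw [h1, ← mul_assoc, ← mul_assoc, ← mul_pow, hE.mul_self_eq_one, one_pow, one_mul]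
  obtain ⟨hd, hder⟩ := h.hasFDerivAt_curvature hpU b'
    (hE.localConnection_add_secondForm hf (hEt p) h hpU) hk hI0 hH0
  refine ⟨hd, fun w ↦ ?_⟩
  rw [hder]
  simp only [hbb, ← hE.secondForm_eq_local hf (hEt p) h hp hfp hpU,
    ← hE.covDerivSecondForm_eq_local hf hEt h hUd hpU]
  rw [extChartAt_to_inv]

end IsUnimodularNormal

end Hypersurface

/-! ### Change of transverse field, the volume condition, constancy -/

namespace Hypersurface

open Filter Topology

variable {n : ℕ} {M : Type*} [TopologicalSpace M] [ChartedSpace (RSpace (n + 1)) M]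
  [IsManifold (𝓡 (n + 1)) ∞ M]
  {S : Type*} [TopologicalSpace S] [ChartedSpace (RSpace n) S] [IsManifold (𝓡 n) ∞ S]
  {f : S → M} {p q : S} {N E ν : (p : S) → TangentSpace (𝓡 (n + 1)) (f p)}
  {g : PseudoRiemannianMetric (n + 1) M}

theorem secondForm_of_eq_smul_add (hf : IsSmoothImmersion n f)
    (hN : N p ∉ Set.range (mfderiv (𝓡 n) (𝓡 (n + 1)) f p))
    (hE : E p ∉ Set.range (mfderiv (𝓡 n) (𝓡 (n + 1)) f p)) {a : ℝ} (ha : a ≠ 0)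
    {z : TangentSpace (𝓡 n) p} (h : N p = a • E p + mfderiv (𝓡 n) (𝓡 (n + 1)) f p z)
    (u v : TangentSpace (𝓡 n) p) :
    secondForm g f N p u v = a⁻¹ * secondForm g f E p u v :=
  (tangentialPart_eq_of_eq_smul_add (hf.2 p) hN hE ha h _).2

theorem inducedConnection_of_eq_smul_add (hf : IsSmoothImmersion n f)
    (hN : N p ∉ Set.range (mfderiv (𝓡 n) (𝓡 (n + 1)) f p))
    (hE : E p ∉ Set.range (mfderiv (𝓡 n) (𝓡 (n + 1)) f p)) {a : ℝ} (ha : a ≠ 0)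
    {z : TangentSpace (𝓡 n) p} (h : N p = a • E p + mfderiv (𝓡 n) (𝓡 (n + 1)) f p z)
    (u v : TangentSpace (𝓡 n) p) :
    inducedConnection g f N (extendVector v) p u =
      inducedConnection g f E (extendVector v) p u - (a⁻¹ * secondForm g f E p u v) • z :=
  (tangentialPart_eq_of_eq_smul_add (hf.2 p) hN hE ha h _).1

namespace IsUnimodularNormal

theorem coeff_eq (hE : IsUnimodularNormal g f ν E) {a : ℝ}
    {z : TangentSpace (𝓡 n) p} (h : N p = a • E p + mfderiv (𝓡 n) (𝓡 (n + 1)) f p z) :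
    a = g.val (f p) (E p) (E p) * g.val (f p) (E p) (N p) := by
  rw [h, map_add, hE.orthogonal, map_smul, add_zero, smul_eq_mul, mul_left_comm,
    hE.mul_self_eq_one, mul_one]

/-- The coefficient is only given pointwise, but pairing with `E` expresses it through smooth
functions. -/
theorem differentiableAt_coeff (hE : IsUnimodularNormal g f ν E) (hN : IsSmoothAlong f N)
    {a : S → ℝ} {z : (p : S) → TangentSpace (𝓡 n) p}
    (h : ∀ p, N p = a p • E p + mfderiv (𝓡 n) (𝓡 (n + 1)) f p (z p)) (p : S) :
    DifferentiableAt ℝ (fun x ↦ a ((extChartAt (𝓡 n) p).symm x)) (extChartAt (𝓡 n) p p) := by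
  have hp := mem_extChartAt_source (I := 𝓡 n) p
  have h1 := contDiffAt_comp_chart_symm hp
    (g.contMDiffAt_val_apply hE.smooth.contMDiffAt hE.smooth.contMDiffAt)
  have h2 := contDiffAt_comp_chart_symm hp
    (g.contMDiffAt_val_apply hE.smooth.contMDiffAt (hN.contMDiffAt (x := p)))
  have h3 : a = fun p ↦ g.val (f p) (E p) (E p) * g.val (f p) (E p) (N p) :=
    funext fun p ↦ hE.coeff_eq (h p)
  rw [h3]
  exact (h1.differentiableAt (by simp)).mul (h2.differentiableAt (by simp))

/-- The product rule for `a⁻¹ h` gives the term in `l = da`, and the change `-a⁻¹ h(u, v) z` of the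
connection gives the last one. The form `l` need not be known, since it cancels in the alignment
condition. -/
theorem exists_covDerivSecondForm_eq (hE : IsUnimodularNormal g f ν E)
    (hf : IsSmoothImmersion n f)
    (hEt : ∀ q, E q ∉ Set.range (mfderiv (𝓡 n) (𝓡 (n + 1)) f q))
    (hNt : ∀ q, N q ∉ Set.range (mfderiv (𝓡 n) (𝓡 (n + 1)) f q)) (hN : IsSmoothAlong f N)
    {a : S → ℝ} (ha : ∀ p, a p ≠ 0) {z : (p : S) → TangentSpace (𝓡 n) p}
    (h : ∀ p, N p = a p • E p + mfderiv (𝓡 n) (𝓡 (n + 1)) f p (z p)) (p : S) :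
    ∃ l : TangentSpace (𝓡 n) p →ₗ[ℝ] ℝ, ∀ u v w, covDerivSecondForm g f N p u v w =
      (a p)⁻¹ * covDerivSecondForm g f E p u v w
        - l u * (a p ^ 2)⁻¹ * secondForm g f E p v w
        + (a p ^ 2)⁻¹ * (secondForm g f E p u v * secondForm g f E p (z p) w
          + secondForm g f E p u w * secondForm g f E p v (z p)) := by
  obtain ⟨U, hUd, hpU, hU⟩ := hE.exists_isNormalField hf.1 p
  obtain ⟨Φ, hΦ, -⟩ := hE.exists_secondForm_bilin hf hEt p
  have hp := mem_extChartAt_source (I := 𝓡 n) p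
  set α : RSpace n → ℝ := fun x ↦ a ((extChartAt (𝓡 n) p).symm x) with hα
  have hαd : DifferentiableAt ℝ α (extChartAt (𝓡 n) p p) := hE.differentiableAt_coeff hN h p
  have hαp : α (extChartAt (𝓡 n) p p) = a p := by rw [hα]; simp only [extChartAt_to_inv]
  refine ⟨(fderiv ℝ α (extChartAt (𝓡 n) p p) ∘L chartDeriv p p).toLinearMap, fun u v w ↦ ?_⟩
  set s : RSpace n → ℝ := fun x ↦ secondForm g f E ((extChartAt (𝓡 n) p).symm x)
    (extendVector v _) (extendVector w _) with hs
  have hsd : DifferentiableAt ℝ s (extChartAt (𝓡 n) p p) :=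
    (hU.differentiableAt_secondForm hpU (chartDeriv p p v)
      (chartDeriv p p w)).congr_of_eventuallyEq
      (hE.secondForm_extendVector_eventuallyEq hf hEt hU hUd hpU v w)
  have hsp : s (extChartAt (𝓡 n) p p) = secondForm g f E p v w := by
    have h1 : secondForm g f E p (extendVector v p) (extendVector w p) =
      secondForm g f E p v w := by rw [extendVector_self, extendVector_self]
    rw [← h1]
    exact congrArg (fun q ↦ secondForm g f E q (extendVector v q) (extendVector w q))
      (PartialEquiv.left_inv _ hp)
  have hprod : (fun x ↦ secondForm g f N ((extChartAt (𝓡 n) p).symm x)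
      (extendVector v _) (extendVector w _)) = fun x ↦ (α x)⁻¹ * s x :=
    funext fun x ↦ secondForm_of_eq_smul_add hf (hNt _) (hEt _) (ha _) (h _) _ _
  have hα0 : α (extChartAt (𝓡 n) p p) ≠ 0 := by rw [hαp]; exact ha p
  have hinv : HasFDerivAt (fun x ↦ (α x)⁻¹)
      (-(a p ^ 2)⁻¹ • fderiv ℝ α (extChartAt (𝓡 n) p p)) (extChartAt (𝓡 n) p p) := by
    have h1 := (hasDerivAt_inv hα0).comp_hasFDerivAt _ hαd.hasFDerivAt
    rwa [hαp] at h1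
  have hder := hinv.mul hsd.hasFDerivAt
  have h1 := mvfderiv_eq_fderiv_comp_chartDeriv
    (h := fun q ↦ secondForm g f N q (extendVector v q) (extendVector w q)) hp
    (by rw [hprod]; exact hder.differentiableAt)
  have h2 := mvfderiv_eq_fderiv_comp_chartDeriv
    (h := fun q ↦ secondForm g f E q (extendVector v q) (extendVector w q)) hp hsd
  have h3 : fderiv ℝ (fun x ↦ (α x)⁻¹ * s x) (extChartAt (𝓡 n) p p) = _ := hder.fderiv
  rw [hprod, h3, hαp, hsp] at h1
  have h4 : mvfderiv (𝓡 n)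
      (fun q ↦ secondForm g f N q (extendVector v q) (extendVector w q)) p u =
      (a p)⁻¹ * mvfderiv (𝓡 n)
        (fun q ↦ secondForm g f E q (extendVector v q) (extendVector w q)) p u +
      secondForm g f E p v w *
        (-(a p ^ 2)⁻¹ * (fderiv ℝ α (extChartAt (𝓡 n) p p) (chartDeriv p p u))) := by
    rw [h1, h2]
    rfl
  have h5 : (fderiv ℝ α (extChartAt (𝓡 n) p p) ∘L chartDeriv p p).toLinearMap u =
    fderiv ℝ α (extChartAt (𝓡 n) p p) (chartDeriv p p u) := rfl
  rw [h5, covDerivSecondForm, covDerivSecondForm, h4,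
    inducedConnection_of_eq_smul_add hf (hNt p) (hEt p) (ha p) (h p),
    inducedConnection_of_eq_smul_add hf (hNt p) (hEt p) (ha p) (h p),
    secondForm_of_eq_smul_add hf (hNt p) (hEt p) (ha p) (h p),
    secondForm_of_eq_smul_add hf (hNt p) (hEt p) (ha p) (h p)]
  simp only [← hΦ, map_sub, map_smul, LinearMap.sub_apply, LinearMap.smul_apply, smul_eq_mul]
  have := ha p
  field_simp
  ring

/-- The alignment condition in terms of the tangential part of the transverse field. -/
theorem trace_covDerivSecondForm (hE : IsUnimodularNormal g f ν E) (hn : 2 ≤ n)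
    (hf : IsSmoothImmersion n f)
    (hEt : ∀ q, E q ∉ Set.range (mfderiv (𝓡 n) (𝓡 (n + 1)) f q))
    (hNt : ∀ q, N q ∉ Set.range (mfderiv (𝓡 n) (𝓡 (n + 1)) f q)) (hN : IsSmoothAlong f N)
    (hal : IsAligned g f N) (haff : IsAffinelyNondegenerate g f)
    {c : ℝ} (hg : g.HasConstantCurvature c)
    {a : S → ℝ} (ha : ∀ p, a p ≠ 0) {z : (p : S) → TangentSpace (𝓡 n) p}
    (h : ∀ p, N p = a p • E p + mfderiv (𝓡 n) (𝓡 (n + 1)) f p (z p)) (p : S)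
    (b : Module.Basis (Fin n) ℝ (TangentSpace (𝓡 n) p)) (w : TangentSpace (𝓡 n) p) :
    ∑ i, ∑ j, (Matrix.of fun i j ↦ secondForm g f E p (b i) (b j))⁻¹ i j *
        covDerivSecondForm g f E p w (b i) (b j) =
      -(((n : ℝ) + 2) / a p * secondForm g f E p (z p) w) := by
  obtain ⟨Φ, hΦ, hΦs⟩ := hE.exists_secondForm_bilin hf hEt p
  obtain ⟨l, hl⟩ := hE.exists_covDerivSecondForm_eq hf hEt hNt hN ha h p
  have h0 := hE.det_secondForm_ne_zero hf hEt haff b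
  have h1 := hal p b w
  simp only [secondForm_of_eq_smul_add hf (hNt p) (hEt p) (ha p) (h p)] at h1
  simp only [← hΦ] at h0 hl h1 ⊢
  exact LinearMap.trace_eq_of_aligned hn b hΦs h0
    (T := covDerivSecondForm g f E p) (D := covDerivSecondForm g f N p)
    (fun u v w ↦ (hE.covDerivSecondForm_symm hf hEt hg u v w).2)
    (fun u v w ↦ (hE.covDerivSecondForm_symm hf hEt hg u v w).1) (ha p) hl h1

end IsUnimodularNormal

/-- A function on a connected manifold with vanishing derivative is constant. -/
theorem exists_eq_of_fderiv_comp_chart_symm_eq_zero [PreconnectedSpace S] {K : S → ℝ}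
    (hK : ∀ p, HasFDerivAt (fun x ↦ K ((extChartAt (𝓡 n) p).symm x))
      (0 : RSpace n →L[ℝ] ℝ) (extChartAt (𝓡 n) p p)) (p q : S) : K p = K q := by
  refine IsLocallyConstant.apply_eq_of_preconnectedSpace
    ((IsLocallyConstant.iff_eventually_eq K).2 fun p ↦ ?_) p q
  obtain ⟨r, hr, hball⟩ := Metric.mem_nhds_iff.1 (extChartAt_target_mem_nhds (I := 𝓡 n) p)
  -- The hypothesis concerns each point in its own chart; the chain rule for the change of charts
  -- transfers it to a fixed chart on a ball.
  have hder : ∀ x ∈ Metric.ball (extChartAt (𝓡 n) p p) r,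
      HasFDerivAt (fun x ↦ K ((extChartAt (𝓡 n) p).symm x)) (0 : RSpace n →L[ℝ] ℝ) x := by
    intro x hx
    obtain ⟨q, hq, rfl⟩ : ∃ q ∈ (extChartAt (𝓡 n) p).source, extChartAt (𝓡 n) p q = x :=
      ⟨_, PartialEquiv.map_target _ (hball hx), PartialEquiv.right_inv _ (hball hx)⟩
    have hqq := mem_extChartAt_source (I := 𝓡 n) q
    have h1 := (contDiffAt_chartChange hq hqq).differentiableAt (by simp)
    have h2 : chartChange p q (extChartAt (𝓡 n) p q) = extChartAt (𝓡 n) q q := by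
      rw [chartChange, PartialEquiv.left_inv _ hq]
    have h3 := HasFDerivAt.comp (extChartAt (𝓡 n) p q)
      (g := fun x ↦ K ((extChartAt (𝓡 n) q).symm x)) (by rw [h2]; exact hK q) h1.hasFDerivAt
    rw [ContinuousLinearMap.zero_comp] at h3
    refine h3.congr_of_eventuallyEq ?_
    have h4 : ∀ᶠ x in 𝓝 (extChartAt (𝓡 n) p q),
        (extChartAt (𝓡 n) p).symm x ∈ (extChartAt (𝓡 n) q).source :=
      (contMDiffAt_chart_symm (PartialEquiv.map_source _ hq)).continuousAt.preimage_mem_nhds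
        ((isOpen_extChartAt_source q).mem_nhds (by rwa [PartialEquiv.left_inv _ hq]))
    filter_upwards [h4] with x hx
    rw [Function.comp_apply, chartChange, PartialEquiv.left_inv _ hx]
  have hconst : ∀ x ∈ Metric.ball (extChartAt (𝓡 n) p p) r,
      K ((extChartAt (𝓡 n) p).symm x) = K p := by
    intro x hx
    have h1 := Metric.isOpen_ball.is_const_of_fderiv_eq_zero
      (convex_ball (extChartAt (𝓡 n) p p) r).isPreconnected
      (fun y hy ↦ (hder y hy).differentiableAt.differentiableWithinAt)
      (fun y hy ↦ (hder y hy).fderiv) hx (Metric.mem_ball_self hr)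
    simpa only [extChartAt_to_inv] using h1
  have h1 : ∀ᶠ q in 𝓝 p, extChartAt (𝓡 n) p q ∈ Metric.ball (extChartAt (𝓡 n) p p) r :=
    (continuousAt_extChartAt p).preimage_mem_nhds (Metric.ball_mem_nhds _ hr)
  filter_upwards [h1, extChartAt_source_mem_nhds (I := 𝓡 n) p] with q hq hq'
  rw [← hconst _ hq, PartialEquiv.left_inv _ hq']

namespace IsUnimodularNormal

theorem gaussKroneckerCurvature_ne_zero (hE : IsUnimodularNormal g f ν E)
    (hf : IsSmoothImmersion n f)
    (hEt : ∀ q, E q ∉ Set.range (mfderiv (𝓡 n) (𝓡 (n + 1)) f q))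
    (haff : IsAffinelyNondegenerate g f) (p : S) : gaussKroneckerCurvature g f E p ≠ 0 := by
  obtain ⟨U, hUd, hpU, hU⟩ := hE.exists_isNormalField hf.1 p
  let b : Module.Basis (Fin n) ℝ (TangentSpace (𝓡 n) p) :=
    (EuclideanSpace.basisFun (Fin n) ℝ).toBasis
  intro hK
  refine hE.det_secondForm_ne_zero hf hEt haff b ?_
  rw [hE.gaussKroneckerCurvature_mul_det hf (hEt p) hU (mem_extChartAt_source p)
    (mem_extChartAt_source (f p)) hpU b, hK, mul_zero, zero_mul]

/-- For `N = a E` the squared volume condition reads `a² |det I| = a⁻ⁿ |det h|`, and `|det h| = |K|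
|det I|`. -/
theorem pow_eq_abs_gaussKroneckerCurvature (hE : IsUnimodularNormal g f ν E)
    (hN : IsEquiaffineNormal g f ν N)
    (hf : IsSmoothImmersion n f)
    (hEt : ∀ q, E q ∉ Set.range (mfderiv (𝓡 n) (𝓡 (n + 1)) f q))
    (hNt : ∀ q, N q ∉ Set.range (mfderiv (𝓡 n) (𝓡 (n + 1)) f q))
    (hmet : IsMetricallyNondegenerate g f) {a : ℝ} (ha : 0 < a) (h : N p = a • E p) :
    a ^ (n + 2) = |gaussKroneckerCurvature g f E p| := by
  obtain ⟨U, hUd, hpU, hU⟩ := hE.exists_isNormalField hf.1 p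
  have hp := mem_extChartAt_source (I := 𝓡 n) p
  have hfp := mem_extChartAt_source (I := 𝓡 (n + 1)) (f p)
  have hz : N p = a • E p + mfderiv (𝓡 n) (𝓡 (n + 1)) f p 0 := by rw [map_zero, add_zero, h]
  let b : Module.Basis (Fin n) ℝ (TangentSpace (𝓡 n) p) :=
    (EuclideanSpace.basisFun (Fin n) ℝ).toBasis
  have hvol := hN.volume p b
  have hI := hmet.det_firstForm_ne_zero b
  have hH := hE.gaussKroneckerCurvature_mul_det hf (hEt p) hU hp hfp hpU b
  set I : Matrix (Fin n) (Fin n) ℝ := Matrix.of fun i j ↦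
    g.val (f p) (mfderiv (𝓡 n) (𝓡 (n + 1)) f p (b i))
      (mfderiv (𝓡 n) (𝓡 (n + 1)) f p (b j)) with hIdef
  have h1 : (Matrix.of fun i j ↦ g.val (f p)
      (Matrix.vecCons (N p) (fun i ↦ mfderiv (𝓡 n) (𝓡 (n + 1)) f p (b i)) i)
      (Matrix.vecCons (N p) (fun i ↦ mfderiv (𝓡 n) (𝓡 (n + 1)) f p (b i)) j)).det =
      a ^ 2 * g.val (f p) (E p) (E p) * I.det := by
    -- Orthogonality of `E` makes the Gram matrix block diagonal, so expansion along the first row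
    -- has a single term.
    rw [Matrix.det_succ_row_zero, Fin.sum_univ_succ, Finset.sum_eq_zero, add_zero]
    · have h2 : ((Matrix.of fun i j ↦ g.val (f p)
          (Matrix.vecCons (N p) (fun i ↦ mfderiv (𝓡 n) (𝓡 (n + 1)) f p (b i)) i)
          (Matrix.vecCons (N p) (fun i ↦ mfderiv (𝓡 n) (𝓡 (n + 1)) f p (b i)) j)).submatrix
          Fin.succ (Fin.succAbove 0)) = I := by
        ext i j
        simp [hIdef]
      rw [h2]
      have h3 : g.val (f p) (N p) (N p) = a ^ 2 * g.val (f p) (E p) (E p) := by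
        simp [h]
        ring
      simp [h3]
    · intro j _
      simp [h, hE.orthogonal]
  have h2 : (Matrix.of fun i j ↦ secondForm g f N p (b i) (b j)).det =
      a⁻¹ ^ n * (Matrix.of fun i j ↦ secondForm g f E p (b i) (b j)).det := by
    have h3 : (Matrix.of fun i j ↦ secondForm g f N p (b i) (b j)) =
        a⁻¹ • (Matrix.of fun i j ↦ secondForm g f E p (b i) (b j)) := by
      ext i j
      exact secondForm_of_eq_smul_add hf (hNt p) (hEt p) ha.ne' hz _ _
    rw [h3, Matrix.det_smul, Fintype.card_fin]
  have h3 := (Real.sqrt_inj (abs_nonneg _) (abs_nonneg _)).1 hvol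
  rw [h1, h2, hH] at h3
  simp only [abs_mul, abs_pow, hE.unimodular, one_pow, one_mul, mul_one, abs_inv,
    abs_of_pos ha] at h3
  rw [← mul_assoc] at h3
  have h4 := mul_right_cancel₀ (abs_ne_zero.2 hI) h3
  rw [add_comm, pow_add, h4, mul_right_comm, ← mul_pow, inv_mul_cancel₀ ha.ne', one_pow, one_mul]

end IsUnimodularNormal

theorem covDerivAlong_const_smul (hf : ContMDiff (𝓡 n) (𝓡 (n + 1)) ∞ f)
    (hN : IsSmoothAlong f N) (hE : IsSmoothAlong f E) {a : ℝ} (h : ∀ p, N p = a • E p)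
    (u : TangentSpace (𝓡 n) p) : covDerivAlong g f N p u = a • covDerivAlong g f E p u := by
  have hp := mem_extChartAt_source (I := 𝓡 n) p
  have hfp := mem_extChartAt_source (I := 𝓡 (n + 1)) (f p)
  refine chartDeriv_injective hfp ?_
  rw [map_smul, chartDeriv_covDerivAlong g hf hp hfp hN.contMDiffAt,
    chartDeriv_covDerivAlong g hf hp hfp hE.contMDiffAt]
  have h1 : localField f p N = a • localField f p E := by
    funext x
    rw [localField, h, map_smul]
    rfl
  rw [h1, LocalMetric.covDeriv_apply, LocalMetric.covDeriv_apply, fderiv_const_smul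
    ((contDiffAt_localField hp hfp hE.contMDiffAt).differentiableAt (by simp)),
    smul_apply, Pi.smul_apply, map_smul, smul_add]

/-- Proportional fields define the same tangential projection, and constancy of `a` lets it pass
through `∇̂`; hence the shape operators differ by the factor `a`. -/
theorem meanCurvature_const_smul (hf : IsSmoothImmersion n f)
    (hEt : ∀ q, E q ∉ Set.range (mfderiv (𝓡 n) (𝓡 (n + 1)) f q))
    (hNt : ∀ q, N q ∉ Set.range (mfderiv (𝓡 n) (𝓡 (n + 1)) f q))
    (hN : IsSmoothAlong f N) (hE : IsSmoothAlong f E) {a : ℝ} (ha : a ≠ 0)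
    (h : ∀ p, N p = a • E p) :
    meanCurvature g f N p = a * meanCurvature g f E p := by
  have h1 : (shapeOperator g f N p).toLinearMap = a • (shapeOperator g f E p).toLinearMap := by
    refine LinearMap.ext fun u ↦ ?_
    have hz : N p = a • E p + mfderiv (𝓡 n) (𝓡 (n + 1)) f p 0 := by rw [map_zero, add_zero, h]
    have h2 : shapeOperator g f N p u = -tangentialPart f N p (covDerivAlong g f N p u) := rfl
    have h3 : shapeOperator g f E p u = -tangentialPart f E p (covDerivAlong g f E p u) := rfl
    have h4 : shapeOperator g f N p u = a • shapeOperator g f E p u := by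
      rw [h2, h3, covDerivAlong_const_smul hf.1 hN hE h,
        (tangentialPart_eq_of_eq_smul_add (hf.2 p) (hNt p) (hEt p) ha hz _).1, smul_zero,
        sub_zero, map_smul, smul_neg]
    exact h4
  rw [meanCurvature, meanCurvature, h1, map_smul, smul_eq_mul, mul_left_comm]

end Hypersurface

end

theorem theorem4p2 {n : ℕ} (hn : 2 ≤ n)
    {M : Type*} [TopologicalSpace M] [ChartedSpace (RSpace (n + 1)) M]
    [IsManifold (𝓡 (n + 1)) ∞ M]
    {S : Type*} [TopologicalSpace S] [ChartedSpace (RSpace n) S] [IsManifold (𝓡 n) ∞ S]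
    [PreconnectedSpace S]
    (g : PseudoRiemannianMetric (n + 1) M) (hg : ∃ c : ℝ, g.HasConstantCurvature c)
    (f : S → M) (hf : Hypersurface.IsSmoothImmersion n f)
    (ν : (p : S) → TangentSpace (𝓡 (n + 1)) (f p)) (hν : Hypersurface.IsCoorientation f ν)
    (haff : Hypersurface.IsAffinelyNondegenerate g f)
    (hmet : Hypersurface.IsMetricallyNondegenerate g f)
    (N : (p : S) → TangentSpace (𝓡 (n + 1)) (f p))
    (hN : Hypersurface.IsEquiaffineNormal g f ν N)
    (E : (p : S) → TangentSpace (𝓡 (n + 1)) (f p))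
    (hE : Hypersurface.IsUnimodularNormal g f ν E) :
    ((∀ p, ∃ a : ℝ, N p = a • E p) ↔
      ∃ K : ℝ, ∀ p, Hypersurface.gaussKroneckerCurvature g f E p = K) ∧
    ((∃ K : ℝ, ∀ p, Hypersurface.gaussKroneckerCurvature g f E p = K) →
      ∃ a : ℝ, 0 < a ∧ (∀ p, N p = a • E p) ∧
        ∀ p, Hypersurface.meanCurvature g f N p = a * Hypersurface.meanCurvature g f E p) := by
  have hEt := hE.cooriented.notMem_range hν
  have hNt := hN.cooriented.notMem_range hν
  obtain ⟨c, hc⟩ := hg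
  choose a ha z hz using hN.cooriented.exists_eq_smul_add hE.cooriented
  have ha0 (p : S) : a p ≠ 0 := (ha p).ne'
  let b (p : S) : Module.Basis (Fin n) ℝ (TangentSpace (𝓡 n) p) :=
    (EuclideanSpace.basisFun (Fin n) ℝ).toBasis
  have htrace := fun p w ↦ hE.trace_covDerivSecondForm hn hf hEt hNt hN.smooth hN.aligned haff hc
    ha0 hz p (b p) w
  have hder := fun p ↦ hE.fderiv_gaussKroneckerCurvature hf hEt haff hmet (b p)
  have hK0 := hE.gaussKroneckerCurvature_ne_zero hf hEt haff
  have key (hK : ∃ K : ℝ, ∀ p, Hypersurface.gaussKroneckerCurvature g f E p = K) (p : S) :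
      N p = a p • E p := by
    obtain ⟨K, hK⟩ := hK
    -- Constancy of `K` gives `0 = -K ((n + 2) / a) h(z, w)` for all `w`, with nonzero factors, so
    -- nondegeneracy of `h` applies.
    have hz0 : z p = 0 := by
      refine haff.eq_zero hf (hEt p) fun w ↦ ?_
      have h1 := (hder p).2 w
      simp only [hK, fderiv_fun_const, Pi.zero_apply, zero_apply, htrace] at h1
      have hKK : K ≠ 0 := hK p ▸ hK0 p
      have hn2 : (n : ℝ) + 2 ≠ 0 := by positivity
      simpa [hKK, hn2, ha0 p] using h1.symm
    rw [hz p, hz0, map_zero, add_zero]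
  refine ⟨⟨fun h ↦ ?_, fun h p ↦ ⟨a p, key h p⟩⟩, fun h ↦ ?_⟩
  -- The pointwise factor `t` is not assumed positive or continuous; uniqueness of the splitting by
  -- `E` removes `z`.
  · have hz0 (p : S) : z p = 0 := by
      obtain ⟨t, ht⟩ := h p
      have h1 := Hypersurface.tangentialPart_apply (hf.2 p) (hEt p) (z p) (a p)
      have h2 := Hypersurface.tangentialPart_apply (hf.2 p) (hEt p) 0 t
      rw [map_zero, zero_add, ← ht, hz p, add_comm (a p • E p), h1] at h2
      exact h2
    have hconst := Hypersurface.exists_eq_of_fderiv_comp_chart_symm_eq_zero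
      (K := Hypersurface.gaussKroneckerCurvature g f E) fun p ↦ by
        have h1 := (hder p).1.hasFDerivAt
        rwa [show fderiv ℝ _ _ = 0 from ContinuousLinearMap.ext fun w ↦ by
          obtain ⟨w, rfl⟩ := chartDeriv_surjective (mem_extChartAt_source (I := 𝓡 n) p) w
          obtain ⟨Φ, hΦ, -⟩ := hE.exists_secondForm_bilin hf hEt p
          rw [(hder p).2 w, htrace, hz0, ← hΦ, map_zero]
          simp] at h1
    rcases isEmpty_or_nonempty S with hS | ⟨⟨p₀⟩⟩
    · exact ⟨0, fun p ↦ hS.elim p⟩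
    · exact ⟨_, fun p ↦ hconst p p₀⟩
  · rcases isEmpty_or_nonempty S with hS | ⟨⟨p₀⟩⟩
    -- Preconnectedness admits the empty hypersurface, for which any positive constant serves.
    · exact ⟨1, one_pos, fun p ↦ hS.elim p, fun p ↦ hS.elim p⟩
    have hconst (p : S) : a p = a p₀ := by
      obtain ⟨K, hK⟩ := h
      have h1 := fun p ↦ hE.pow_eq_abs_gaussKroneckerCurvature hN hf hEt hNt hmet (ha p)
        (key ⟨K, hK⟩ p)
      simp only [hK] at h1
      -- Both coefficients are nonnegative roots of `x^(n + 2) = |K|`, hence equal.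
      exact (pow_left_inj₀ (ha p).le (ha p₀).le (by omega)).1 ((h1 p).trans (h1 p₀).symm)
    have hNE (p : S) : N p = a p₀ • E p := by rw [key h p, hconst p]
    exact ⟨a p₀, ha p₀, hNE, fun p ↦ Hypersurface.meanCurvature_const_smul hf hEt hNt hN.smooth
      hE.smooth (ha0 p₀) hNE⟩
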